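/- Conventions. Let $n$ be a positive integer and $Y$ a real Banach space with dual $Y^*$ (norm topology). $\mathscr D(\mathbf R^n,Y)$ is the space of smooth, compactly supported functions $\mathbf R^n\to Y$ with its usual locally convex (inductive limit) topology, and $\mathscr D'(\mathbf R^n,Y)$ is the space of continuous linear maps $\mathscr D(\mathbf R^n,Y)\to\mathbf R$. A polynomial function $P:\mathbf R^n\to Y^*$ has the associated distribution $S_P(\phi)=\int\langle\phi,P\rangle\,\mathrm d\mathscr L^n$; a polynomial function of degree at most $-1$ is the zero function. For $\phi\in\mathscr D(\mathbf R^n,Y)$, $a\in\mathbf R^n$ and $r>0$ put $\phi_{a,r}(x)=\phi(r^{-1}(x-a))$. For a nonnegative integer $i$ let $$\boldsymbol\nu^i_{\mathbf B(0,1)}(\phi)=\sup\{\|\mathrm D^m\phi(x)\| : x\in\mathbf B(0,1),\ m=0,\ldots,i\},$$ where $\mathbf B(0,1)$ is the closed unit ball, and let $\Phi_i$ be the set of all $\phi\in\mathscr D(\mathbf R^n,Y)$ with $\operatorname{spt}\phi\subset\mathbf B(0,1)$ and $\boldsymbol\nu^i_{\mathbf B(0,1)}(\phi)\le 1$. Let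 $T\in\mathscr D'(\mathbf R^n,Y)$ and $a\in\mathbf R^n$. * For a nonnegative integer $k$, $T$ is pointwise differentiable of order $k$ at $a$ if there is a polynomial function $P:\mathbf R^n\to Y^*$ of degree at most $k$ with $\lim_{r\to0+}r^{-k-n}(T-S_P)(\phi_{a,r})=0$ for every $\phi\in\mathscr D(\mathbf R^n,Y)$. Such a $P$ is unique, and $\operatorname{pt}\mathrm D^kT(a)=\mathrm D^kP(a)$. * For a nonnegative integer $k$, $T$ is $\boldsymbol\nu^i_{\mathbf B(0,1)}$ pointwise differentiable of order $k$ at $a$ if there is a polynomial function $P:\mathbf R^n\to Y^*$ of degree at most $k$ with $\lim_{r\to0+}\sup_{\phi\in\Phi_i}r^{-k-n}(T-S_P)(\phi_{a,r})=0$. * For an integer $k$ and $0<\alpha\le1$ with $k+\alpha\ge0$, $T$ is $\boldsymbol\nu^i_{\mathbf B(0,1)}$ pointwise differentiable of order $(k,\alpha)$ at $a$ if there is a polynomial function $P:\mathbf R^n\to Y^*$ of degree at most $k$ with $\limsup_{r\to0+}\sup_{\phi\in\Phi_i}r^{-k-\alpha-n}(T-S_P)(\phi_{a,r})<\infty$.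 **Theorem.** Let $i$ and $k$ be nonnegative integers, let $Y$ be a separable Banach space, let $R\in\mathscr D'(\mathbf R^n,Y)$, and let $A$ be the set of all $a\in\mathbf R^n$ such that $R$ is $\boldsymbol\nu^i_{\mathbf B(0,1)}$ pointwise differentiable of order $(k-1,1)$ at $a$ and $\operatorname{pt}\mathrm D^mR(a)=0$ for $m=0,\ldots,k-1$. Then $\mathscr L^n$ almost all $a\in A$ satisfy the following three statements: 1. $R$ is pointwise differentiable of order $k$ at $a$. 2. If $k>0$ or $Y^*$ is separable, then $R$ is $\boldsymbol\nu^i_{\mathbf B(0,1)}$ pointwise differentiable of order $k$ at $a$. 3. If $k>0$, then $\operatorname{pt}\mathrm D^kR(a)=0$. -/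

import Mathlib

open MeasureTheory Filter Topology TopologicalSpace

noncomputable section

namespace PtDiff

/-- `𝒟(ℝⁿ, Y)`: smooth compactly supported functions `ℝⁿ → Y`, with the usual locally convex
inductive limit topology.  (Here `⊤ : ℕ∞` means smooth.) -/
abbrev TestFn (n : ℕ) (Y : Type*) [NormedAddCommGroup Y] [NormedSpace ℝ Y] :=
  TestFunction (⊤ : Opens (EuclideanSpace ℝ (Fin n))) Y ⊤

/-- `𝒟'(ℝⁿ, Y)`: the continuous linear maps `𝒟(ℝⁿ, Y) → ℝ`. -/
abbrev Distr (n : ℕ) (Y : Type*) [NormedAddCommGroup Y] [NormedSpace ℝ Y] :=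
  TestFn n Y →L[ℝ] ℝ

variable {n : ℕ} {Y : Type*} [NormedAddCommGroup Y] [NormedSpace ℝ Y]

theorem hasCompactSupport_rescale (φ : TestFn n Y) (a : EuclideanSpace ℝ (Fin n)) {r : ℝ}
    (hr : r ≠ 0) : HasCompactSupport (fun x => φ (r⁻¹ • (x - a))) :=
  φ.hasCompactSupport.comp_homeomorph
    ((Homeomorph.subRight a).trans (Homeomorph.smulOfNeZero r⁻¹ (inv_ne_zero hr)))

/-- The test function `x ↦ φ (r⁻¹ (x - a))` for `r ≠ 0`; it is only used for `r > 0`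
(the value for `r = 0` is irrelevant and set to `0`). -/
def rescale (a : EuclideanSpace ℝ (Fin n)) (r : ℝ) (φ : TestFn n Y) : TestFn n Y :=
  if hr : r ≠ 0 then
    { toFun := fun x => φ (r⁻¹ • (x - a))
      contDiff' := φ.contDiff.comp ((contDiff_id.sub contDiff_const).const_smul r⁻¹)
      hasCompactSupport' := hasCompactSupport_rescale φ a hr
      tsupport_subset' := fun _ _ => trivial }
  else 0

theorem rescale_apply (a : EuclideanSpace ℝ (Fin n)) {r : ℝ} (hr : r ≠ 0) (φ : TestFn n Y)
    (x : EuclideanSpace ℝ (Fin n)) : rescale a r φ x = φ (r⁻¹ • (x - a)) := by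
  simp only [rescale, dif_pos hr]
  rfl

/-- `P : ℝⁿ → W` is a polynomial function of degree at most `k`: it is a sum of homogeneous
terms `c_m (x, …, x)` with `c_m` an `m`-linear map, `0 ≤ m ≤ k`.  For `k = -1` the sum is empty,
so that `P` is the zero function. -/
def IsPolynomialOfDegreeLE {W : Type*} [NormedAddCommGroup W] [NormedSpace ℝ W] (k : ℤ)
    (P : EuclideanSpace ℝ (Fin n) → W) : Prop :=
  ∃ c : (m : ℕ) → ContinuousMultilinearMap ℝ (fun _ : Fin m => EuclideanSpace ℝ (Fin n)) W,
    ∀ x, P x = ∑ m ∈ Finset.range (k + 1).toNat, c m (fun _ => x)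

theorem IsPolynomialOfDegreeLE.continuous {W : Type*} [NormedAddCommGroup W] [NormedSpace ℝ W]
    {k : ℤ} {P : EuclideanSpace ℝ (Fin n) → W} (hP : IsPolynomialOfDegreeLE k P) :
    Continuous P := by
  obtain ⟨c, hc⟩ := hP
  rw [funext hc]
  exact continuous_finsetSum _ fun m _ => (c m).cont.comp (continuous_pi fun _ => continuous_id)

/-- The distribution `φ ↦ ∫ ⟨φ, P⟩ dℒⁿ` associated with a locally integrable
`P : ℝⁿ → Y*` (in particular with a polynomial function). -/
def distrOf (P : EuclideanSpace ℝ (Fin n) → StrongDual ℝ Y) : Distr n Y :=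
  TestFunction.integralAgainstBilinCLM (ContinuousLinearMap.apply ℝ ℝ) volume P

theorem distrOf_apply {k : ℤ} {P : EuclideanSpace ℝ (Fin n) → StrongDual ℝ Y}
    (hP : IsPolynomialOfDegreeLE k P) (φ : TestFn n Y) :
    distrOf P φ = ∫ x, P x (φ x) := by
  rw [distrOf, TestFunction.integralAgainstBilinCLM_eq_integral]
  · simp
  · exact hP.continuous.locallyIntegrable.locallyIntegrableOn _

/-- `P` is a polynomial function of degree at most `k` with
`r^{-k-n} (T - S)_x (φ (r⁻¹ (x - a))) → 0` as `r → 0+` for each test function `φ`, where `S` is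
the distribution associated with `P`; that is, `S` is the `k`-jet of `T` at `a`. -/
def IsJet (T : Distr n Y) (k : ℤ) (a : EuclideanSpace ℝ (Fin n))
    (P : EuclideanSpace ℝ (Fin n) → StrongDual ℝ Y) : Prop :=
  IsPolynomialOfDegreeLE k P ∧
    ∀ φ : TestFn n Y,
      Tendsto (fun r : ℝ => r ^ (-k - (n : ℤ)) * (T - distrOf P) (rescale a r φ))
        (𝓝[>] 0) (𝓝 0)

/-- `T` is pointwise differentiable of order `k` at `a`. -/
def PointwiseDifferentiable (T : Distr n Y) (k : ℤ) (a : EuclideanSpace ℝ (Fin n)) : Prop :=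
  ∃ P, IsJet T k a P

/-- `T` is pointwise differentiable of order `m` at `a`, and its `m`-th order pointwise
differential `pt D^m T (a) = D^m P (a)` equals `ψ`. -/
def HasPointwiseDifferential (T : Distr n Y) (m : ℕ) (a : EuclideanSpace ℝ (Fin n))
    (ψ : ContinuousMultilinearMap ℝ (fun _ : Fin m => EuclideanSpace ℝ (Fin n))
      (StrongDual ℝ Y)) : Prop :=
  ∃ P, IsJet T m a P ∧ iteratedFDeriv ℝ m P a = ψ

/-- The seminorm `ν^i_K (φ) = sup {‖D^m φ (x)‖ : x ∈ K, m = 0, …, i}`. -/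
def nu (i : ℕ) (K : Set (EuclideanSpace ℝ (Fin n))) (φ : TestFn n Y) : ℝ :=
  sSup {s : ℝ | ∃ m ≤ i, ∃ x ∈ K, s = ‖iteratedFDeriv ℝ m φ x‖}

/-- The test functions `φ` with support in the closed unit ball and `ν φ ≤ 1`. -/
def unitTestFns (ν : TestFn n Y → ℝ) : Set (TestFn n Y) :=
  {φ | tsupport φ ⊆ Metric.closedBall 0 1 ∧ ν φ ≤ 1}

/-- `T` is `ν` pointwise differentiable of order `k` at `a`: the limit condition holds uniformly
on `unitTestFns ν`. The supremum is computed in the extended real numbers. -/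
def NuPointwiseDifferentiable (ν : TestFn n Y → ℝ) (T : Distr n Y) (k : ℤ)
    (a : EuclideanSpace ℝ (Fin n)) : Prop :=
  ∃ P : EuclideanSpace ℝ (Fin n) → StrongDual ℝ Y, IsPolynomialOfDegreeLE k P ∧
    Tendsto (fun r : ℝ => ⨆ φ ∈ unitTestFns ν,
        ((r ^ (-k - (n : ℤ)) * (T - distrOf P) (rescale a r φ) : ℝ) : EReal))
      (𝓝[>] 0) (𝓝 0)

/-- `T` is `ν` pointwise differentiable of order `(k, α)` at `a`. The supremum and the upper limit
are computed in the extended real numbers. -/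
def NuPointwiseDifferentiableHolder (ν : TestFn n Y → ℝ) (T : Distr n Y) (k : ℤ) (α : ℝ)
    (a : EuclideanSpace ℝ (Fin n)) : Prop :=
  ∃ P : EuclideanSpace ℝ (Fin n) → StrongDual ℝ Y, IsPolynomialOfDegreeLE k P ∧
    limsup (fun r : ℝ => ⨆ φ ∈ unitTestFns ν,
        ((r ^ (-(k : ℝ) - α - (n : ℝ)) * (T - distrOf P) (rescale a r φ) : ℝ) : EReal))
      (𝓝[>] 0) < ⊤

end PtDiff

end

open scoped ContDiff

noncomputable section

namespace PtDiff

/-! The vanishing of the differentials of order below `k` forces the polynomial in the `(k - 1, 1)`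
condition to be zero: jets of different orders at `a` are compared coefficient by coefficient
(`eq_zero_of_hasPointwiseDifferential_zero`). Hence `A` is covered by countably many bounded sets
`boundedOrderSet R i k N`, on each of which `|R (rescale a r φ)| ≤ N r ^ (n + k)` with uniform
constants. Almost every point of such a set is a density point of its closure, and it suffices to
treat these.

For `k > 0`, at a density point `a` every point of the ball of radius `r` is eventually within `ε r`
of the set. A partition of unity of mesh `ε r` cuts the test function into about `ε ^ (-n)` pieces,
each contributing at most a constant times `(ε r) ^ (n + k)`. The total is of order `ε ^ k r ^ (n +
k)`, and `ε` is arbitrary (`LocBound.eventually_le`). So the `k`-jet is zero, uniformly in the test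
function.

For `k = 0` this gains nothing. Instead `R` is split using cutoffs near the set at scales `2⁻¹ ^ l`.
Consecutive cutoffs differ only where the distance to the set is comparable to the scale; `R` of
that part is controlled by the volume of a ring, and the rings overlap boundedly outside the
closure. So the cutoff values converge to a linear functional `Λ` (`LocBound.exists_limit`), and at
density points `R - Λ` is `o(r ^ n)` uniformly (`LocBound.eventually_sub_le`). Averaging the cell
bounds shows that `Λ` is bounded by an integral norm on a ball (`LocBound.limit_le`).

Such a `Λ` has a scalar density in each direction `y`. Common Lebesgue points of the densities for a
countable dense set of directions give a limit in `Y*` for every test function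
(`ae_exists_dual_tendsto`). If `Y*` is separable, these limits form a strongly measurable density
with values in `Y*`, whose Lebesgue points give uniform convergence (`ae_exists_dual_uniform`). -/

/-- Euclidean space `ℝⁿ`. -/
abbrev Euc (n : ℕ) := EuclideanSpace ℝ (Fin n)

/-! ### Derivative bounds weighted by a length scale. -/

section ScaledBounds

variable {n : ℕ} {F : Type*} [NormedAddCommGroup F] [NormedSpace ℝ F]

/-- `ε^m ‖D^m f (x)‖ ≤ M` for all `x ∈ s` and `m = 0, …, i`. -/
def ScaledBoundOn (i : ℕ) (ε M : ℝ) (f : Euc n → F) (s : Set (Euc n)) : Prop :=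
  ∀ m ≤ i, ∀ x ∈ s, ε ^ m * ‖iteratedFDeriv ℝ m f x‖ ≤ M

theorem ScaledBoundOn.mono {i : ℕ} {ε M : ℝ} {f : Euc n → F} {s t : Set (Euc n)}
    (h : ScaledBoundOn i ε M f s) (hts : t ⊆ s) : ScaledBoundOn i ε M f t :=
  fun m hm x hx => h m hm x (hts hx)

/-- Refining the scale costs nothing. This is why a function controlled at scale `r` can be cut into
pieces of much smaller mesh. -/
theorem ScaledBoundOn.mono_scale {i : ℕ} {ε ε' M : ℝ} {f : Euc n → F} {s : Set (Euc n)}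
    (h : ScaledBoundOn i ε M f s) (h0 : 0 ≤ ε') (hε : ε' ≤ ε) : ScaledBoundOn i ε' M f s :=
  fun m hm x hx => (mul_le_mul_of_nonneg_right (pow_le_pow_left₀ h0 hε m)
    (norm_nonneg _)).trans (h m hm x hx)

theorem ScaledBoundOn.mul_scale {i : ℕ} {ε M κ : ℝ} {f : Euc n → F} {s : Set (Euc n)}
    (h : ScaledBoundOn i ε M f s) (hM : 0 ≤ M) (hκ : 1 ≤ κ) :
    ScaledBoundOn i (κ * ε) (κ ^ i * M) f s := by
  intro m hm x hx
  rw [mul_pow, mul_assoc]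
  calc κ ^ m * (ε ^ m * ‖iteratedFDeriv ℝ m f x‖) ≤ κ ^ m * M :=
        mul_le_mul_of_nonneg_left (h m hm x hx) (by positivity)
    _ ≤ κ ^ i * M := mul_le_mul_of_nonneg_right (pow_le_pow_right₀ hκ hm) hM

theorem ScaledBoundOn.univ_of_tsupport_subset {i : ℕ} {ε M : ℝ} {f : Euc n → F} {s : Set (Euc n)}
    (h : ScaledBoundOn i ε M f s) (hM : 0 ≤ M) (hs : tsupport f ⊆ s) :
    ScaledBoundOn i ε M f Set.univ := by
  intro m hm x _
  by_cases hx : x ∈ s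
  · exact h m hm x hx
  · have : iteratedFDeriv ℝ m f x = 0 := by
      by_contra h0
      exact hx (hs (support_iteratedFDeriv_subset m h0))
    simpa [this] using hM

theorem ScaledBoundOn.norm_le {i : ℕ} {ε M : ℝ} {f : Euc n → F} {s : Set (Euc n)}
    (h : ScaledBoundOn i ε M f s) {x : Euc n} (hx : x ∈ s) : ‖f x‖ ≤ M := by
  simpa using h 0 (Nat.zero_le _) x hx

/-- In the Leibniz formula the weight `ε ^ m` splits as `ε ^ j * ε ^ (m - j)`, and the binomial
coefficients add up to `2 ^ m`. -/
theorem ScaledBoundOn.smul {i : ℕ} {ε A B : ℝ} {g : Euc n → ℝ} {f : Euc n → F} {s : Set (Euc n)}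
    (hg : ContDiff ℝ ∞ g) (hf : ContDiff ℝ ∞ f) (hε : 0 ≤ ε) (hA : 0 ≤ A) (hB : 0 ≤ B)
    (h1 : ScaledBoundOn i ε A g s) (h2 : ScaledBoundOn i ε B f s) :
    ScaledBoundOn i ε (2 ^ i * (A * B)) (fun x => g x • f x) s := by
  intro m hm x hx
  have key := norm_iteratedFDeriv_smul_le hg hf x (n := m) (by exact_mod_cast le_top)
  calc ε ^ m * ‖iteratedFDeriv ℝ m (fun x => g x • f x) x‖
      ≤ ε ^ m * ∑ j ∈ Finset.range (m + 1), (m.choose j : ℝ) * ‖iteratedFDeriv ℝ j g x‖ *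
          ‖iteratedFDeriv ℝ (m - j) f x‖ := mul_le_mul_of_nonneg_left key (by positivity)
    _ = ∑ j ∈ Finset.range (m + 1), (m.choose j : ℝ) * ((ε ^ j * ‖iteratedFDeriv ℝ j g x‖) *
          (ε ^ (m - j) * ‖iteratedFDeriv ℝ (m - j) f x‖)) := by
        rw [Finset.mul_sum]
        refine Finset.sum_congr rfl fun j hj => ?_
        rw [← Nat.add_sub_of_le (Nat.lt_succ_iff.1 (Finset.mem_range.1 hj)), pow_add,
          Nat.add_sub_cancel_left]
        ring
    _ ≤ ∑ j ∈ Finset.range (m + 1), (m.choose j : ℝ) * (A * B) := by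
        refine Finset.sum_le_sum fun j hj => ?_
        have hj' := Nat.lt_succ_iff.1 (Finset.mem_range.1 hj)
        refine mul_le_mul_of_nonneg_left ?_ (by positivity)
        exact mul_le_mul (h1 j (hj'.trans hm) x hx) (h2 (m - j) ((Nat.sub_le _ _).trans hm) x hx)
          (by positivity) hA
    _ = 2 ^ m * (A * B) := by
        rw [← Finset.sum_mul]
        congr 1
        exact_mod_cast Nat.sum_range_choose m
    _ ≤ 2 ^ i * (A * B) := by
        gcongr
        norm_num

theorem ScaledBoundOn.comp_rescale {i : ℕ} {ε M r : ℝ} {f : Euc n → F} (hf : ContDiff ℝ ∞ f)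
    (h : ScaledBoundOn i ε M f Set.univ) (a : Euc n) (hr : 0 < r) :
    ScaledBoundOn i (r * ε) M (fun x => f (r⁻¹ • (x - a))) Set.univ := by
  intro m hm x _
  have h1 : iteratedFDeriv ℝ m (fun x => f (r⁻¹ • (x - a))) x
      = r⁻¹ ^ m • iteratedFDeriv ℝ m f (r⁻¹ • (x - a)) := by
    rw [iteratedFDeriv_comp_sub (f := fun z => f (r⁻¹ • z)) m a x,
      iteratedFDeriv_comp_const_smul _ (hf.of_le (by exact_mod_cast le_top))]
  rw [h1, norm_smul, norm_pow, norm_inv, Real.norm_of_nonneg hr.le]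
  have := h m hm (r⁻¹ • (x - a)) trivial
  calc (r * ε) ^ m * (r⁻¹ ^ m * ‖iteratedFDeriv ℝ m f (r⁻¹ • (x - a))‖)
      = (r * r⁻¹) ^ m * (ε ^ m * ‖iteratedFDeriv ℝ m f (r⁻¹ • (x - a))‖) := by ring
    _ ≤ M := by rw [mul_inv_cancel₀ hr.ne', one_pow, one_mul]; exact this

theorem exists_scaledBoundOn_univ {f : Euc n → F} (hf : ContDiff ℝ ∞ f) (hc : HasCompactSupport f)
    (i : ℕ) : ∃ M, 0 ≤ M ∧ ScaledBoundOn i 1 M f Set.univ := by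
  have h : ∀ m : ℕ, ∃ C, ∀ x, ‖iteratedFDeriv ℝ m f x‖ ≤ C := fun m =>
    (hc.iteratedFDeriv m).exists_bound_of_continuous
      (hf.continuous_iteratedFDeriv (by exact_mod_cast le_top))
  choose C hC using h
  have hC0 : ∀ m, 0 ≤ C m := fun m => (norm_nonneg _).trans (hC m 0)
  refine ⟨∑ m ∈ Finset.range (i + 1), C m, Finset.sum_nonneg fun m _ => hC0 m, ?_⟩
  intro m hm x _
  rw [one_pow, one_mul]
  exact (hC m x).trans (Finset.single_le_sum (fun j _ => hC0 j)
    (Finset.mem_range.2 (Nat.lt_succ_of_le hm)))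

end ScaledBounds

/-! ### Smooth lattice partitions of unity and counting of cells by volume. -/

section LatticePartition

/-- The radius of the cells of the lattice partition of unity, measured in units of the mesh. -/
def cellRadius (n : ℕ) : ℝ := n + 1

theorem one_le_cellRadius (n : ℕ) : 1 ≤ cellRadius n := by simp [cellRadius]

theorem cellRadius_pos (n : ℕ) : 0 < cellRadius n := one_pos.trans_le (one_le_cellRadius n)

variable {n : ℕ}

/-- The point of the integer lattice with the given coordinates. -/
def latPt (z : Fin n → ℤ) : Euc n := WithLp.toLp 2 fun j => (z j : ℝ)

/-- A smooth function on `ℝⁿ`, supported in `[-1, 1]ⁿ`, whose integer translates sum up to `1`. -/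
def latBump (x : Euc n) : ℝ :=
  ∏ j, (Real.smoothTransition (x j + 1) - Real.smoothTransition (x j))

theorem contDiff_latBump : ContDiff ℝ ∞ (latBump (n := n)) := by
  refine contDiff_prod fun j _ => ?_
  have h : ContDiff ℝ ∞ fun x : Euc n => x j := contDiff_euclidean.1 contDiff_id j
  exact (Real.smoothTransition.contDiff.comp (h.add contDiff_const)).sub
    (Real.smoothTransition.contDiff.comp h)

theorem smoothTransition_mono : Monotone Real.smoothTransition := by
  have hmono : Monotone expNegInvGlue := expNegInvGlue.monotone
  intro s t hst
  have h1 := hmono hst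
  have h2 := hmono (show 1 - t ≤ 1 - s by linarith)
  have p1 := Real.smoothTransition.pos_denom s
  have p2 := Real.smoothTransition.pos_denom t
  unfold Real.smoothTransition
  rw [div_le_div_iff₀ p1 p2]
  nlinarith [expNegInvGlue.nonneg s, expNegInvGlue.nonneg t, expNegInvGlue.nonneg (1 - s),
    expNegInvGlue.nonneg (1 - t)]

theorem latBump_nonneg (x : Euc n) : 0 ≤ latBump x :=
  Finset.prod_nonneg fun j _ => sub_nonneg.2 (smoothTransition_mono (by linarith))

theorem norm_le_of_latBump_ne_zero {x : Euc n} (hx : latBump x ≠ 0) : ‖x‖ ≤ cellRadius n := by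
  have h : ∀ j, |x j| ≤ 1 := by
    intro j
    have hj := (Finset.prod_ne_zero_iff.1 hx) j (Finset.mem_univ j)
    by_contra hc
    apply hj
    rcases lt_abs.1 (not_le.1 hc) with h1 | h1
    · rw [Real.smoothTransition.one_of_one_le (by linarith),
        Real.smoothTransition.one_of_one_le h1.le, sub_self]
    · rw [Real.smoothTransition.zero_of_nonpos (by linarith),
        Real.smoothTransition.zero_of_nonpos (by linarith), sub_self]
  rw [EuclideanSpace.norm_eq, Real.sqrt_le_left (cellRadius_pos n).le]
  calc ∑ j, ‖x j‖ ^ 2 ≤ ∑ _j : Fin n, (1 : ℝ) := Finset.sum_le_sum fun j _ => by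
        rw [Real.norm_eq_abs]
        exact pow_le_one₀ (abs_nonneg _) (h j)
    _ = n := by simp
    -- The sharp radius would be `√n`; `n + 1` dominates it and is also at least `1`.
    _ ≤ cellRadius n ^ 2 := by
        have : (0 : ℝ) ≤ n := by positivity
        unfold cellRadius
        nlinarith

theorem tsupport_latBump_subset :
    tsupport (latBump (n := n)) ⊆ Metric.closedBall 0 (cellRadius n) :=
  closure_minimal (fun x hx => by simpa using norm_le_of_latBump_ne_zero hx)
    Metric.isClosed_closedBall

theorem hasCompactSupport_latBump : HasCompactSupport (latBump (n := n)) :=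
  (isCompact_closedBall _ _).of_isClosed_subset (isClosed_tsupport _) tsupport_latBump_subset

/-- The sum telescopes, and the range is long enough that the transition equals `1` at one end and
`0` at the other. -/
theorem sum_smoothTransition_diff (t : ℝ) (M : ℕ) (hM : |t| ≤ M) :
    ∑ k ∈ Finset.Ico (-(M : ℤ) - 1) (M + 1), (Real.smoothTransition (t - k + 1)
      - Real.smoothTransition (t - k)) = 1 := by
  have h : ∀ N : ℕ, ∑ k ∈ Finset.Ico (-(M : ℤ) - 1) (-(M : ℤ) - 1 + N),
      (Real.smoothTransition (t - k + 1) - Real.smoothTransition (t - k))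
      = Real.smoothTransition (t + M + 2) - Real.smoothTransition (t + M + 2 - N) := by
    intro N
    induction N with
    | zero => simp
    | succ N ih =>
      have : Finset.Ico (-(M : ℤ) - 1) (-(M : ℤ) - 1 + (N + 1 : ℕ))
          = insert (-(M : ℤ) - 1 + N) (Finset.Ico (-(M : ℤ) - 1) (-(M : ℤ) - 1 + N)) := by
        ext k
        simp only [Finset.mem_Ico, Finset.mem_insert]
        push_cast
        omega
      rw [this, Finset.sum_insert (by simp), ih]
      push_cast
      ring_nf
  have h2 := h (2 * M + 2)
  rw [show -(M : ℤ) - 1 + ((2 * M + 2 : ℕ) : ℤ) = M + 1 by push_cast; ring] at h2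
  rw [h2, Real.smoothTransition.one_of_one_le, Real.smoothTransition.zero_of_nonpos, sub_zero]
  · push_cast
    linarith [(abs_le.1 hM).2]
  · linarith [(abs_le.1 hM).1]

/-- The function of the lattice partition of unity of mesh `ε` belonging to the lattice point
`ε z`. -/
def cellFn (ε : ℝ) (z : Fin n → ℤ) (x : Euc n) : ℝ := latBump (ε⁻¹ • (x - ε • latPt z))

theorem contDiff_cellFn (ε : ℝ) (z : Fin n → ℤ) : ContDiff ℝ ∞ (cellFn ε z) :=
  contDiff_latBump.comp ((contDiff_id.sub contDiff_const).const_smul ε⁻¹)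

theorem cellFn_nonneg (ε : ℝ) (z : Fin n → ℤ) (x : Euc n) : 0 ≤ cellFn ε z x := latBump_nonneg _

theorem dist_le_of_cellFn_ne_zero {ε : ℝ} (hε : 0 < ε) {z : Fin n → ℤ} {x : Euc n}
    (hx : cellFn ε z x ≠ 0) : dist x (ε • latPt z) ≤ cellRadius n * ε := by
  have := norm_le_of_latBump_ne_zero hx
  rw [norm_smul, norm_inv, Real.norm_of_nonneg hε.le, inv_mul_le_iff₀ hε] at this
  rwa [dist_eq_norm, mul_comm]

theorem tsupport_cellFn_subset {ε : ℝ} (hε : 0 < ε) (z : Fin n → ℤ) :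
    tsupport (cellFn ε z) ⊆ Metric.closedBall (ε • latPt z) (cellRadius n * ε) :=
  closure_minimal (fun _ hx => dist_le_of_cellFn_ne_zero hε hx) Metric.isClosed_closedBall

theorem hasCompactSupport_cellFn {ε : ℝ} (hε : 0 < ε) (z : Fin n → ℤ) :
    HasCompactSupport (cellFn ε z) :=
  (isCompact_closedBall _ _).of_isClosed_subset (isClosed_tsupport _) (tsupport_cellFn_subset hε z)

theorem sum_cellFn_eq_one {ε : ℝ} (hε : 0 < ε) {x : Euc n} (T : Finset (Fin n → ℤ))
    (hT : ∀ z, dist x (ε • latPt z) ≤ cellRadius n * ε → z ∈ T) :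
    ∑ z ∈ T, cellFn ε z x = 1 := by
  obtain ⟨M, hM⟩ := exists_nat_ge (‖ε⁻¹ • x‖)
  -- Over a full box of lattice points the sum of products factors into a product of one-dimensional
  -- telescoping sums.
  have hfull : ∑ z ∈ Fintype.piFinset (fun _ : Fin n => Finset.Ico (-(M : ℤ) - 1) (M + 1)),
      cellFn ε z x = 1 := by
    have h1 : ∀ z : Fin n → ℤ, cellFn ε z x = ∏ j, (Real.smoothTransition ((ε⁻¹ • x) j - z j + 1)
        - Real.smoothTransition ((ε⁻¹ • x) j - z j)) := by
      intro z
      unfold cellFn latBump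
      rw [smul_sub, smul_smul, inv_mul_cancel₀ hε.ne', one_smul]
      rfl
    simp_rw [h1]
    rw [← Finset.prod_univ_sum (fun _ : Fin n => Finset.Ico (-(M : ℤ) - 1) ((M : ℤ) + 1))
      (fun j k => Real.smoothTransition ((ε⁻¹ • x) j - k + 1)
        - Real.smoothTransition ((ε⁻¹ • x) j - k))]
    refine Finset.prod_eq_one fun j _ => sum_smoothTransition_diff _ _ ?_
    exact (PiLp.norm_apply_le (ε⁻¹ • x) j).trans hM
  set B := Fintype.piFinset (fun _ : Fin n => Finset.Ico (-(M : ℤ) - 1) ((M : ℤ) + 1))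
  have hz : ∀ z, z ∉ T → cellFn ε z x = 0 := fun z hzT => by
    by_contra h0
    exact hzT (hT z (dist_le_of_cellFn_ne_zero hε h0))
  classical
  -- Indices outside `T` or outside the box contribute `0` at `x`, so both sums agree with the sum
  -- over the union.
  have hU : ∑ z ∈ T ∪ B, cellFn ε z x = ∑ z ∈ T, cellFn ε z x :=
    (Finset.sum_subset Finset.subset_union_left fun z _ h => hz z h).symm
  have hU2 : ∑ z ∈ T ∪ B, cellFn ε z x = ∑ z ∈ B, cellFn ε z x := by
    refine (Finset.sum_subset Finset.subset_union_right fun z _ h => ?_).symm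
    unfold cellFn latBump
    rw [smul_sub, smul_smul, inv_mul_cancel₀ hε.ne', one_smul]
    obtain ⟨j, hj⟩ : ∃ j, z j ∉ Finset.Ico (-(M : ℤ) - 1) ((M : ℤ) + 1) := by
      simpa [B, Fintype.mem_piFinset] using h
    have habs := abs_le.1 ((PiLp.norm_apply_le (ε⁻¹ • x) j).trans hM)
    refine Finset.prod_eq_zero (Finset.mem_univ j) ?_
    change Real.smoothTransition ((ε⁻¹ • x) j - z j + 1)
      - Real.smoothTransition ((ε⁻¹ • x) j - z j) = 0
    rw [Finset.mem_Ico, not_and_or, not_le, not_lt] at hj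
    rcases hj with hj | hj
    · have : (z j : ℝ) + 1 ≤ -M - 1 := by exact_mod_cast hj
      rw [Real.smoothTransition.one_of_one_le (by linarith),
        Real.smoothTransition.one_of_one_le (by linarith), sub_self]
    · have : (M : ℝ) + 1 ≤ z j := by exact_mod_cast hj
      rw [Real.smoothTransition.zero_of_nonpos (by linarith),
        Real.smoothTransition.zero_of_nonpos (by linarith), sub_self]
  rw [← hU, hU2, hfull]

theorem exists_scaledBoundOn_cellFn (n i : ℕ) : ∃ C : ℝ, 0 ≤ C ∧ ∀ ε : ℝ, 0 < ε →
    ∀ z : Fin n → ℤ, ScaledBoundOn i ε C (cellFn ε z) Set.univ := by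
  obtain ⟨C, hC0, hC⟩ := exists_scaledBoundOn_univ (contDiff_latBump (n := n))
    hasCompactSupport_latBump i
  refine ⟨C, hC0, fun ε hε z => ?_⟩
  have h := hC.comp_rescale contDiff_latBump (ε • latPt z) hε
  rw [mul_one] at h
  exact h

theorem one_le_dist_latPt {z w : Fin n → ℤ} (h : z ≠ w) : 1 ≤ dist (latPt z) (latPt w) := by
  obtain ⟨j, hj⟩ := Function.ne_iff.1 h
  have h1 : (1 : ℝ) ≤ |(z j : ℝ) - w j| := by
    exact_mod_cast Int.one_le_abs (sub_ne_zero.2 hj)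
  rw [dist_eq_norm]
  exact h1.trans (PiLp.norm_apply_le (latPt z - latPt w) j)

/-- The volume of the balls around lattice points used for counting. -/
def cellVol (n : ℕ) : ℝ := volume.real (Metric.ball (0 : Euc n) (1 / 2))

theorem cellVol_pos (n : ℕ) : 0 < cellVol n :=
  ENNReal.toReal_pos (Metric.measure_ball_pos volume _ (by norm_num)).ne' measure_ball_lt_top.ne

theorem volume_real_ball_half (x : Euc n) {ε : ℝ} (hε : 0 < ε) :
    volume.real (Metric.ball x (ε / 2)) = ε ^ n * cellVol n := by
  rw [cellVol, Measure.real, div_eq_mul_one_div, Measure.addHaar_ball_mul_of_pos _ _ hε,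
    ENNReal.toReal_mul, ENNReal.toReal_ofReal (by positivity), finrank_euclideanSpace_fin]
  rfl

theorem pairwiseDisjoint_latBall {ε : ℝ} (hε : 0 < ε) (T : Set (Fin n → ℤ)) :
    T.PairwiseDisjoint fun z => Metric.ball (ε • latPt z) (ε / 2) := by
  intro z _ w _ hzw
  refine Metric.ball_disjoint_ball ?_
  rw [dist_smul₀, Real.norm_of_nonneg hε.le]
  nlinarith [one_le_dist_latPt hzw]

/-- Balls of radius `ε / 2` about distinct points of the lattice of mesh `ε` are disjoint, so
counting points reduces to comparing volumes. -/
theorem card_mul_le_volume {ε : ℝ} (hε : 0 < ε) (T : Finset (Fin n → ℤ)) {S : Set (Euc n)}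
    (hS : volume S ≠ ⊤) (hT : ∀ z ∈ T, Metric.ball (ε • latPt z) (ε / 2) ⊆ S) :
    T.card * (ε ^ n * cellVol n) ≤ volume.real S := by
  have h := measureReal_biUnion_finset (μ := (volume : Measure (Euc n)))
    (pairwiseDisjoint_latBall hε (T : Set (Fin n → ℤ)))
    (fun _ _ => measurableSet_ball) (fun _ _ => measure_ball_lt_top.ne)
  rw [Finset.sum_congr rfl fun z _ => volume_real_ball_half (ε • latPt z) hε, Finset.sum_const,
    nsmul_eq_mul] at h
  rw [← h]
  exact measureReal_mono (Set.iUnion₂_subset hT) hS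

/-- The lattice points of mesh `ε` within distance `r` of the set `S`. -/
def cellsNear (S : Set (Euc n)) (ε r : ℝ) : Finset (Fin n → ℤ) :=
  open Classical in
  if h : {z : Fin n → ℤ | Metric.infDist (ε • latPt z) S ≤ r}.Finite then h.toFinset else ∅

theorem mem_cellsNear {S : Set (Euc n)} (hS : Bornology.IsBounded S) (hne : S.Nonempty) {ε : ℝ}
    (hε : 0 < ε) (r : ℝ) (z : Fin n → ℤ) :
    z ∈ cellsNear S ε r ↔ Metric.infDist (ε • latPt z) S ≤ r := by
  have hfin : {z : Fin n → ℤ | Metric.infDist (ε • latPt z) S ≤ r}.Finite := by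
    obtain ⟨ρ, hρ⟩ := hS.subset_closedBall 0
    refine Set.Finite.subset (Set.Finite.pi' fun _ : Fin n =>
      Set.finite_Icc (-⌈ε⁻¹ * (ρ + r + 1)⌉) ⌈ε⁻¹ * (ρ + r + 1)⌉) fun z hz j => ?_
    obtain ⟨y, hy, hyz⟩ := (Metric.infDist_lt_iff hne).1 (show _ < r + 1 from
      lt_of_le_of_lt hz (by linarith))
    have hy' := mem_closedBall_zero_iff.1 (hρ hy)
    have h1 : ‖ε • latPt z‖ ≤ ρ + r + 1 := by
      have := norm_le_norm_add_norm_sub' (ε • latPt z) y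
      rw [← dist_eq_norm] at this
      linarith
    rw [norm_smul, Real.norm_of_nonneg hε.le, ← le_inv_mul_iff₀ hε] at h1
    have h2 : |(z j : ℝ)| ≤ ⌈ε⁻¹ * (ρ + r + 1)⌉ :=
      (PiLp.norm_apply_le (latPt z) j).trans (h1.trans (Int.le_ceil _))
    have h3 : |z j| ≤ ⌈ε⁻¹ * (ρ + r + 1)⌉ := by exact_mod_cast h2
    exact abs_le.1 h3
  rw [cellsNear, dif_pos hfin]
  simp

theorem mem_cellsNear_singleton {c : Euc n} {ε : ℝ} (hε : 0 < ε) (r : ℝ) (z : Fin n → ℤ) :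
    z ∈ cellsNear {c} ε r ↔ dist (ε • latPt z) c ≤ r := by
  rw [mem_cellsNear Bornology.isBounded_singleton (Set.singleton_nonempty c) hε,
    Metric.infDist_singleton]

end LatticePartition

/-! ### From estimates on single cells to estimates on whole test functions. -/

section LocalBounds

variable {n : ℕ} {Y : Type*} [NormedAddCommGroup Y] [NormedSpace ℝ Y]

/-- The product of a test function with a smooth function. -/
def mulTest (g : Euc n → ℝ) (hg : ContDiff ℝ ∞ g) (φ : TestFn n Y) : TestFn n Y where
  toFun := fun x => g x • φ x
  contDiff' := hg.smul φ.contDiff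
  hasCompactSupport' := φ.hasCompactSupport.smul_left
  tsupport_subset' := fun _ _ => trivial

theorem mulTest_apply (g : Euc n → ℝ) (hg : ContDiff ℝ ∞ g) (φ : TestFn n Y) (x : Euc n) :
    mulTest g hg φ x = g x • φ x := rfl

theorem coe_mulTest (g : Euc n → ℝ) (hg : ContDiff ℝ ∞ g) (φ : TestFn n Y) :
    ⇑(mulTest g hg φ) = fun x => g x • φ x := rfl

theorem testFn_sum_apply {ι : Type*} (T : Finset ι) (f : ι → TestFn n Y) (x : Euc n) :
    (∑ z ∈ T, f z) x = ∑ z ∈ T, f z x := by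
  classical
  induction T using Finset.induction_on with
  | empty => simp
  | insert z T hz ih => rw [Finset.sum_insert hz, Finset.sum_insert hz, ← ih]; rfl

/-- `R` is of order `r ^ p` at the points of `A`, uniformly for test functions with bounded scaled
derivatives of order at most `i`. -/
def LocBound (R : TestFn n Y →ₗ[ℝ] ℝ) (i p : ℕ) (A : Set (Euc n)) (N δ : ℝ) : Prop :=
  ∀ a ∈ A, ∀ ρ : ℝ, 0 < ρ → ρ < δ → ∀ (ψ : TestFn n Y) (M : ℝ), 0 ≤ M →
    tsupport ψ ⊆ Metric.closedBall a ρ → ScaledBoundOn i ρ M ψ Set.univ → |R ψ| ≤ N * M * ρ ^ p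

/-- A bound for the scaled derivatives of the functions `cellFn ε z`. -/
def cellBound (n i : ℕ) : ℝ := Classical.choose (exists_scaledBoundOn_cellFn n i)

theorem cellBound_nonneg (n i : ℕ) : 0 ≤ cellBound n i :=
  (Classical.choose_spec (exists_scaledBoundOn_cellFn n i)).1

theorem scaledBoundOn_cellFn (i : ℕ) {ε : ℝ} (hε : 0 < ε) (z : Fin n → ℤ) :
    ScaledBoundOn i ε (cellBound n i) (cellFn ε z) Set.univ :=
  (Classical.choose_spec (exists_scaledBoundOn_cellFn n i)).2 ε hε z

/-- The constant in `LocBound.cell_estimate`. -/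
def cellConst (n i p : ℕ) : ℝ := (9 * cellRadius n) ^ (i + p) * (2 ^ i * cellBound n i)

theorem cellConst_nonneg (n i p : ℕ) : 0 ≤ cellConst n i p := by
  have := cellBound_nonneg n i
  have := cellRadius_pos n
  unfold cellConst
  positivity

/-- A cell near `A` lies in a ball of radius `9 * cellRadius n * ε` about some point of `A`, where
the hypothesis applies. Passing from scale `ε` to that radius costs `(9 * cellRadius n) ^ i` for the
derivatives and `(9 * cellRadius n) ^ p` for the power of the radius. -/
theorem LocBound.cell_estimate {R : TestFn n Y →ₗ[ℝ] ℝ} {i p : ℕ} {A : Set (Euc n)} {N δ : ℝ}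
    (hR : LocBound R i p A N δ) (hA : A.Nonempty) {ε : ℝ} (hε : 0 < ε)
    (hεδ : 9 * cellRadius n * ε < δ) {z : Fin n → ℤ}
    (hz : Metric.infDist (ε • latPt z) A ≤ 7 * cellRadius n * ε) {φ : TestFn n Y} {M : ℝ}
    (hM : 0 ≤ M)
    (hφ : ScaledBoundOn i ε M φ (Metric.closedBall (ε • latPt z) (cellRadius n * ε))) :
    |R (mulTest (cellFn ε z) (contDiff_cellFn ε z) φ)| ≤ cellConst n i p * N * M * ε ^ p := by
  have hs := one_le_cellRadius n
  have hB := cellBound_nonneg n i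
  obtain ⟨a, ha, haz⟩ := (Metric.infDist_lt_iff hA).1 (lt_of_le_of_lt hz
    (show _ < 8 * cellRadius n * ε by nlinarith))
  have hsub : tsupport (mulTest (cellFn ε z) (contDiff_cellFn ε z) φ)
      ⊆ Metric.closedBall (ε • latPt z) (cellRadius n * ε) :=
    (tsupport_smul_subset_left (cellFn ε z) φ).trans (tsupport_cellFn_subset hε z)
  have h1 : ScaledBoundOn i ε (2 ^ i * (cellBound n i * M))
      (mulTest (cellFn ε z) (contDiff_cellFn ε z) φ) Set.univ := by
    refine ScaledBoundOn.univ_of_tsupport_subset ?_ (by positivity) hsub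
    rw [coe_mulTest]
    exact ScaledBoundOn.smul (contDiff_cellFn ε z) φ.contDiff hε.le hB hM
      ((scaledBoundOn_cellFn i hε z).mono (Set.subset_univ _)) hφ
  have h2 := h1.mul_scale (by positivity) (show 1 ≤ 9 * cellRadius n by linarith)
  have h3 := hR a ha (9 * cellRadius n * ε) (by positivity) hεδ _ _ (by positivity)
    (hsub.trans (Metric.closedBall_subset_closedBall' (by nlinarith))) h2
  refine h3.trans (le_of_eq ?_)
  unfold cellConst
  rw [pow_add, mul_pow (9 * cellRadius n) ε p]
  ring

theorem eq_sum_mulTest_cellFn {ε : ℝ} (hε : 0 < ε) (φ : TestFn n Y) (T : Finset (Fin n → ℤ))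
    (hT : ∀ x z, φ x ≠ 0 → dist x (ε • latPt z) ≤ cellRadius n * ε → z ∈ T) :
    φ = ∑ z ∈ T, mulTest (cellFn ε z) (contDiff_cellFn ε z) φ := by
  ext x
  rw [testFn_sum_apply]
  simp only [mulTest_apply]
  rw [← Finset.sum_smul]
  by_cases hx : φ x = 0
  · simp [hx]
  · rw [sum_cellFn_eq_one hε T fun z hz => hT x z hx hz, one_smul]

/-- The number of cells meeting the support is at most `volume.real S / (ε ^ n * cellVol n)`, and
each obeys the cell estimate. Stating the bound through `S` serves both uses: a ball for `k > 0`, a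
ring for `k = 0`. -/
theorem LocBound.sum_estimate {R : TestFn n Y →ₗ[ℝ] ℝ} {i p : ℕ} {A : Set (Euc n)} {N δ : ℝ}
    (hR : LocBound R i p A N δ) (hA : A.Nonempty) (hN : 0 ≤ N) {ε : ℝ} (hε : 0 < ε)
    (hεδ : 9 * cellRadius n * ε < δ) {φ : TestFn n Y} {M : ℝ} (hM : 0 ≤ M)
    (hφ : ScaledBoundOn i ε M φ Set.univ)
    (hφA : ∀ x, φ x ≠ 0 → Metric.infDist x A ≤ 6 * cellRadius n * ε) {S : Set (Euc n)}
    (hS : volume S ≠ ⊤)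
    (hφS : ∀ x, φ x ≠ 0 → Metric.closedBall x ((cellRadius n + 1 / 2) * ε) ⊆ S) :
    |R φ| * (ε ^ n * cellVol n) ≤ cellConst n i p * N * M * ε ^ p * volume.real S := by
  classical
  obtain ⟨ρ, hρ⟩ := φ.hasCompactSupport.isCompact.isBounded.subset_closedBall 0
  set T := (cellsNear {(0 : Euc n)} ε (ρ + cellRadius n * ε)).filter
    fun z => ∃ x, φ x ≠ 0 ∧ dist x (ε • latPt z) ≤ cellRadius n * ε with hTdef
  have hT : ∀ x z, φ x ≠ 0 → dist x (ε • latPt z) ≤ cellRadius n * ε → z ∈ T := by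
    intro x z hx hxz
    refine Finset.mem_filter.2 ⟨(mem_cellsNear_singleton hε _ z).2 ?_, x, hx, hxz⟩
    have h1 : dist x 0 ≤ ρ := hρ (subset_tsupport _ hx)
    have := dist_triangle_left (ε • latPt z) 0 x
    linarith
  have hcell : ∀ z ∈ T, |R (mulTest (cellFn ε z) (contDiff_cellFn ε z) φ)|
      ≤ cellConst n i p * N * M * ε ^ p := by
    intro z hz
    obtain ⟨x, hx, hxz⟩ := (Finset.mem_filter.1 hz).2
    refine hR.cell_estimate hA hε hεδ ?_ hM (hφ.mono (Set.subset_univ _))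
    have h1 := hφA x hx
    have h2 := Metric.infDist_le_infDist_add_dist (s := A) (x := ε • latPt z) (y := x)
    rw [dist_comm] at h2
    linarith
  have hcard := card_mul_le_volume hε T hS fun z hz => by
    obtain ⟨x, hx, hxz⟩ := (Finset.mem_filter.1 hz).2
    refine (Metric.ball_subset_closedBall.trans
      (Metric.closedBall_subset_closedBall' ?_)).trans (hφS x hx)
    rw [dist_comm]
    linarith
  have hsum : |R φ| ≤ T.card * (cellConst n i p * N * M * ε ^ p) := by
    conv_lhs => rw [eq_sum_mulTest_cellFn hε φ T hT, map_sum]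
    refine (Finset.abs_sum_le_sum_abs _ _).trans ((Finset.sum_le_sum hcell).trans ?_)
    rw [Finset.sum_const, nsmul_eq_mul]
  have hc := cellConst_nonneg n i p
  have hv := cellVol_pos n
  calc |R φ| * (ε ^ n * cellVol n)
      ≤ T.card * (cellConst n i p * N * M * ε ^ p) * (ε ^ n * cellVol n) :=
        mul_le_mul_of_nonneg_right hsum (by positivity)
    _ = cellConst n i p * N * M * ε ^ p * (T.card * (ε ^ n * cellVol n)) := by ring
    _ ≤ _ := mul_le_mul_of_nonneg_left hcard (by positivity)

end LocalBounds

/-! ### Lebesgue density of the closure. -/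

section DensityPoints

variable {n : ℕ}

/-- The complement of the closure of `A` has density zero at `a`. -/
def IsDensityPt (A : Set (Euc n)) (a : Euc n) : Prop :=
  Tendsto (fun r : ℝ => volume.real ((closure A)ᶜ ∩ Metric.closedBall a r) / r ^ n)
    (𝓝[>] 0) (𝓝 0)

theorem volume_real_closedBall (a : Euc n) {r : ℝ} (hr : 0 ≤ r) :
    volume.real (Metric.closedBall a r) = r ^ n * volume.real (Metric.closedBall (0 : Euc n) 1) := by
  rw [Measure.real, Measure.addHaar_closedBall' _ _ hr, ENNReal.toReal_mul,
    ENNReal.toReal_ofReal (by positivity), finrank_euclideanSpace_fin]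
  rfl

/-- This is the Lebesgue density theorem for the complement of the closure. Working with the closure
avoids any measurability question about `A`. -/
theorem ae_isDensityPt (A : Set (Euc n)) : ∀ᵐ a ∂volume, a ∈ A → IsDensityPt A a := by
  filter_upwards [Besicovitch.ae_tendsto_measure_inter_div_of_measurableSet
    (volume : Measure (Euc n)) (isClosed_closure (s := A)).measurableSet.compl] with a ha haA
  rw [Set.indicator_of_notMem (by simpa using subset_closure haA)] at ha
  have h1 := (ENNReal.tendsto_toReal ENNReal.zero_ne_top).comp ha
  have h2 := h1.mul_const (volume.real (Metric.closedBall (0 : Euc n) 1))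
  rw [ENNReal.toReal_zero, zero_mul] at h2
  refine h2.congr' ?_
  filter_upwards [self_mem_nhdsWithin] with r hr
  have hr0 : (0 : ℝ) < r := hr
  have hpos : 0 < volume.real (Metric.closedBall (0 : Euc n) 1) :=
    ENNReal.toReal_pos (Metric.measure_closedBall_pos volume _ one_pos).ne'
      measure_closedBall_lt_top.ne
  simp only [Function.comp_apply, ENNReal.toReal_div]
  change volume.real _ / volume.real (Metric.closedBall a r) * _ = _
  rw [volume_real_closedBall a hr0.le]
  field_simp

theorem tendsto_const_mul_nhdsGT_zero {t : ℝ} (ht : 0 < t) :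
    Tendsto (fun r : ℝ => t * r) (𝓝[>] 0) (𝓝[>] 0) := by
  refine tendsto_nhdsWithin_of_tendsto_nhds_of_eventually_within _ ?_ ?_
  · have : Tendsto (fun r : ℝ => t * r) (𝓝 0) (𝓝 (t * 0)) := tendsto_id.const_mul t
    rw [mul_zero] at this
    exact this.mono_left nhdsWithin_le_nhds
  · filter_upwards [self_mem_nhdsWithin] with r hr
    exact mul_pos ht hr

theorem IsDensityPt.eventually_volume_le {A : Set (Euc n)} {a : Euc n} (h : IsDensityPt A a)
    {c η : ℝ} (hc : 0 < c) (hη : 0 < η) : ∀ᶠ r : ℝ in 𝓝[>] 0,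
      volume.real ((closure A)ᶜ ∩ Metric.closedBall a (c * r)) ≤ η * r ^ n := by
  have := (h.comp (tendsto_const_mul_nhdsGT_zero hc)).eventually (ge_mem_nhds (show (0 : ℝ) < η / c ^ n by positivity))
  filter_upwards [this, self_mem_nhdsWithin] with r hr hr0
  have hr0 : (0 : ℝ) < r := hr0
  simp only [Function.comp_apply] at hr
  rw [div_le_iff₀ (by positivity), mul_pow] at hr
  have h1 : η / c ^ n * (c ^ n * r ^ n) = η * r ^ n := by field_simp
  rwa [h1] at hr

/-- If some point of the ball were farther than `ε r` from `A`, a ball of radius `ε r` would miss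
the closure and fill a fixed fraction of a ball of radius `(1 + ε) r` about `a`. -/
theorem IsDensityPt.eventually_infDist_le {A : Set (Euc n)} {a : Euc n} (h : IsDensityPt A a)
    {ε : ℝ} (hε : 0 < ε) : ∀ᶠ r : ℝ in 𝓝[>] 0,
      ∀ x ∈ Metric.closedBall a r, Metric.infDist x A ≤ ε * r := by
  have hv := cellVol_pos n
  filter_upwards [h.eventually_volume_le (show 0 < 1 + ε by positivity)
    -- Half the volume of a ball of radius `ε r`, divided by `r ^ n`: the missing ball would exceed
    -- it strictly.
    (show 0 < (2 * ε) ^ n * cellVol n / 2 by positivity), self_mem_nhdsWithin] with r hr hr0 x hx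
  have hr0 : (0 : ℝ) < r := hr0
  by_contra hcon
  rw [not_le] at hcon
  have hsub : Metric.ball x (2 * ε * r / 2) ⊆ (closure A)ᶜ ∩ Metric.closedBall a ((1 + ε) * r) := by
    intro y hy
    have hy' : dist y x < ε * r := by
      have := Metric.mem_ball.1 hy
      linarith
    refine ⟨fun hyA => ?_, ?_⟩
    · have h1 := Metric.infDist_le_dist_of_mem (x := x) hyA
      rw [Metric.infDist_closure, dist_comm] at h1
      linarith
    · have h2 := dist_triangle y x a
      have h3 := Metric.mem_closedBall.1 hx
      rw [Metric.mem_closedBall]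
      linarith
  have h1 := measureReal_mono (μ := volume) hsub
    (measure_ne_top_of_subset Set.inter_subset_right measure_closedBall_lt_top.ne)
  rw [volume_real_ball_half x (show 0 < 2 * ε * r by positivity), mul_pow] at h1
  have h2 : 0 < (2 * ε) ^ n * r ^ n * cellVol n := by positivity
  linarith

end DensityPoints

/-! ### Rescaled test functions, and the improvement for positive order. -/

section Rescaling

variable {n : ℕ} {Y : Type*} [NormedAddCommGroup Y] [NormedSpace ℝ Y]

theorem coe_rescale (a : Euc n) {r : ℝ} (hr : r ≠ 0) (φ : TestFn n Y) :
    ⇑(rescale a r φ) = fun x => φ (r⁻¹ • (x - a)) := funext (rescale_apply a hr φ)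

theorem rescale_add (a : Euc n) (r : ℝ) (φ ψ : TestFn n Y) :
    rescale a r (φ + ψ) = rescale a r φ + rescale a r ψ := by
  by_cases hr : r = 0
  · simp [rescale, hr]
  · ext x
    change rescale a r (φ + ψ) x = rescale a r φ x + rescale a r ψ x
    simp only [rescale_apply a hr]
    rfl

theorem rescale_smul (a : Euc n) (r c : ℝ) (φ : TestFn n Y) :
    rescale a r (c • φ) = c • rescale a r φ := by
  by_cases hr : r = 0
  · simp [rescale, hr]
  · ext x
    change rescale a r (c • φ) x = c • rescale a r φ x
    simp only [rescale_apply a hr]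
    rfl

/-- `rescale` as a linear map. -/
def rescaleₗ (a : Euc n) (r : ℝ) : TestFn n Y →ₗ[ℝ] TestFn n Y where
  toFun := rescale a r
  map_add' := rescale_add a r
  map_smul' := rescale_smul a r

theorem tsupport_rescale_subset (a : Euc n) {r ρ : ℝ} (hr : 0 < r) {φ : TestFn n Y}
    (hφ : tsupport φ ⊆ Metric.closedBall 0 ρ) :
    tsupport (rescale a r φ) ⊆ Metric.closedBall a (r * ρ) := by
  refine closure_minimal (fun x hx => ?_) Metric.isClosed_closedBall
  rw [Function.mem_support, rescale_apply a hr.ne'] at hx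
  have := mem_closedBall_zero_iff.1 (hφ (subset_tsupport _ hx))
  rw [norm_smul, norm_inv, Real.norm_of_nonneg hr.le, inv_mul_le_iff₀ hr] at this
  rwa [Metric.mem_closedBall, dist_eq_norm]

theorem ScaledBoundOn.rescale {i : ℕ} {ε M r : ℝ} {φ : TestFn n Y}
    (h : ScaledBoundOn i ε M φ Set.univ) (a : Euc n) (hr : 0 < r) :
    ScaledBoundOn i (r * ε) M (PtDiff.rescale a r φ) Set.univ := by
  rw [coe_rescale a hr.ne']
  exact h.comp_rescale φ.contDiff a hr

theorem nu_le_of_scaledBoundOn {i : ℕ} {M : ℝ} {φ : TestFn n Y} (hM : 0 ≤ M)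
    (h : ScaledBoundOn i 1 M φ Set.univ) : nu i (Metric.closedBall 0 1) φ ≤ M := by
  refine Real.sSup_le ?_ hM
  rintro s ⟨m, hm, x, -, rfl⟩
  simpa using h m hm x trivial

/-- The seminorm only sees the unit ball, but the support condition extends the bound everywhere.
The supremum is an honest one because the derivatives of a test function are bounded. -/
theorem scaledBoundOn_of_mem_unitTestFns {i : ℕ} {φ : TestFn n Y}
    (hφ : φ ∈ unitTestFns (nu i (Metric.closedBall 0 1))) : ScaledBoundOn i 1 1 φ Set.univ := by
  refine ScaledBoundOn.univ_of_tsupport_subset (s := Metric.closedBall 0 1) ?_ zero_le_one hφ.1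
  intro m hm x hx
  rw [one_pow, one_mul]
  have hmem : ‖iteratedFDeriv ℝ m φ x‖ ∈ {s : ℝ | ∃ m ≤ i, ∃ x ∈ Metric.closedBall (0 : Euc n) 1,
      s = ‖iteratedFDeriv ℝ m φ x‖} := ⟨m, hm, x, hx, rfl⟩
  refine (le_csSup ?_ hmem).trans hφ.2
  obtain ⟨M, -, hM⟩ := exists_scaledBoundOn_univ φ.contDiff φ.hasCompactSupport i
  refine ⟨M, ?_⟩
  rintro s ⟨m, hm, x, -, rfl⟩
  simpa using hM m hm x trivial

theorem rescale_rescale (a : Euc n) {r t : ℝ} (hr : r ≠ 0) (ht : t ≠ 0) (φ : TestFn n Y) :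
    rescale a (t * r) (rescale 0 t⁻¹ φ) = rescale a r φ := by
  ext x
  rw [rescale_apply a (mul_ne_zero ht hr), rescale_apply 0 (inv_ne_zero ht), rescale_apply a hr,
    sub_zero, inv_inv, smul_smul, mul_inv, mul_inv_cancel_left₀ ht]

/-- Every test function is a multiple of a rescaled element of `unitTestFns`. -/
theorem exists_rescale_eq (i : ℕ) (φ : TestFn n Y) : ∃ c t : ℝ, 0 < c ∧ 0 < t ∧
    ∃ ψ ∈ unitTestFns (nu i (Metric.closedBall 0 1)), ∀ (a : Euc n) (r : ℝ), r ≠ 0 →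
      rescale a r φ = c • rescale a (t * r) ψ := by
  obtain ⟨ρ, hρ⟩ := φ.hasCompactSupport.isCompact.isBounded.subset_closedBall 0
  set t := max ρ 1
  have ht : 0 < t := one_pos.trans_le (le_max_right _ _)
  obtain ⟨M, hM0, hM⟩ := exists_scaledBoundOn_univ (rescale 0 t⁻¹ φ).contDiff
    (rescale 0 t⁻¹ φ).hasCompactSupport i
  have hc : 0 < M + 1 := by positivity
  refine ⟨M + 1, t, hc, ht, (M + 1)⁻¹ • rescale 0 t⁻¹ φ, ⟨?_, ?_⟩, fun a r hr => ?_⟩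
  · refine (closure_mono (Function.support_const_smul_subset _ _)).trans
      ((tsupport_rescale_subset 0 (inv_pos.2 ht) (hρ.trans
        (Metric.closedBall_subset_closedBall (le_max_left ρ 1)))).trans (le_of_eq ?_))
    rw [inv_mul_cancel₀ ht.ne']
  · refine nu_le_of_scaledBoundOn zero_le_one fun m hm x hx => ?_
    have h1 : iteratedFDeriv ℝ m ⇑((M + 1)⁻¹ • rescale 0 t⁻¹ φ) x
        = (M + 1)⁻¹ • iteratedFDeriv ℝ m (rescale 0 t⁻¹ φ) x :=
      iteratedFDeriv_const_smul_apply ((rescale 0 t⁻¹ φ).contDiff.contDiffAt.of_le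
        (by exact_mod_cast le_top))
    rw [h1, norm_smul, Real.norm_of_nonneg (by positivity), mul_left_comm, inv_mul_le_iff₀ hc]
    linarith [hM m hm x hx]
  · rw [rescale_smul, smul_inv_smul₀ hc.ne', rescale_rescale a hr ht.ne']

theorem zero_mem_unitTestFns (i : ℕ) :
    (0 : TestFn n Y) ∈ unitTestFns (nu i (Metric.closedBall 0 1)) := by
  refine ⟨?_, nu_le_of_scaledBoundOn zero_le_one fun m hm x hx => ?_⟩
  · have : (⇑(0 : TestFn n Y)) = 0 := rfl
    rw [this, tsupport_zero]
    exact Set.empty_subset _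
  · have : (⇑(0 : TestFn n Y)) = 0 := rfl
    rw [this, iteratedFDeriv_zero]
    simp

theorem neg_mem_unitTestFns {i : ℕ} {φ : TestFn n Y}
    (hφ : φ ∈ unitTestFns (nu i (Metric.closedBall 0 1))) :
    -φ ∈ unitTestFns (nu i (Metric.closedBall 0 1)) := by
  have hcoe : ⇑(-φ) = -⇑φ := rfl
  refine ⟨?_, nu_le_of_scaledBoundOn zero_le_one fun m hm x hx => ?_⟩
  · rw [hcoe, tsupport, Function.support_neg]
    exact hφ.1
  · rw [hcoe, iteratedFDeriv_neg, Pi.neg_apply, norm_neg]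
    exact scaledBoundOn_of_mem_unitTestFns hφ m hm x hx

/-- `LocBound` follows from bounds for the rescaled elements of `unitTestFns`. -/
theorem locBound_of_unitTestFns {R : TestFn n Y →ₗ[ℝ] ℝ} {i p : ℕ} {A : Set (Euc n)} {N δ : ℝ}
    (h : ∀ a ∈ A, ∀ r : ℝ, 0 < r → r < δ →
      ∀ φ ∈ unitTestFns (nu i (Metric.closedBall 0 1)), |R (rescale a r φ)| ≤ N * r ^ p) :
    LocBound R i p A N δ := by
  intro a ha ρ hρ hρδ ψ M hM hsupp hψ
  -- For `M = 0` normalisation by `M⁻¹` is unavailable, but then `ψ` vanishes.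
  rcases hM.eq_or_lt with rfl | hM
  · have : ψ = 0 := by
      ext x
      simpa using hψ.norm_le (Set.mem_univ x)
    simp [this]
  set θ : TestFn n Y := rescale (-(ρ⁻¹ • a)) ρ⁻¹ ψ
  have hθ : ∀ x, θ x = ψ (ρ • x + a) := fun x => by
    simp only [θ]
    rw [rescale_apply _ (inv_ne_zero hρ.ne'), inv_inv, sub_neg_eq_add, smul_add,
      smul_inv_smul₀ hρ.ne']
  have hθb : ScaledBoundOn i 1 M θ Set.univ := by
    have := hψ.rescale (-(ρ⁻¹ • a)) (inv_pos.2 hρ)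
    rwa [inv_mul_cancel₀ hρ.ne'] at this
  have hmem : M⁻¹ • θ ∈ unitTestFns (nu i (Metric.closedBall 0 1)) := by
    refine ⟨(closure_mono (Function.support_const_smul_subset _ _)).trans
      (closure_minimal (fun x hx => ?_) Metric.isClosed_closedBall),
      nu_le_of_scaledBoundOn zero_le_one fun m hm x hx => ?_⟩
    · rw [Function.mem_support, hθ] at hx
      have := Metric.mem_closedBall.1 (hsupp (subset_tsupport _ hx))
      rw [dist_eq_norm, add_sub_cancel_right, norm_smul, Real.norm_of_nonneg hρ.le] at this
      rw [mem_closedBall_zero_iff]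
      nlinarith
    · have h1 : iteratedFDeriv ℝ m ⇑(M⁻¹ • θ) x = M⁻¹ • iteratedFDeriv ℝ m θ x :=
        iteratedFDeriv_const_smul_apply (θ.contDiff.contDiffAt.of_le
          (by exact_mod_cast le_top))
      rw [h1, norm_smul, Real.norm_of_nonneg (by positivity), mul_left_comm, inv_mul_le_iff₀ hM,
        mul_one]
      exact hθb m hm x hx
  have h1 := h a ha ρ hρ hρδ _ hmem
  have h2 : rescale a ρ (M⁻¹ • θ) = M⁻¹ • ψ := by
    rw [rescale_smul]
    congr 1
    ext x
    rw [rescale_apply _ hρ.ne', hθ, smul_inv_smul₀ hρ.ne', sub_add_cancel]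
  rw [h2, map_smul, smul_eq_mul, abs_mul, abs_of_pos (inv_pos.2 hM), inv_mul_le_iff₀ hM] at h1
  linarith

/-- At density points, a bound of order `r ^ (n + k)` with `k > 0` improves to `o(r ^ (n + k))`. -/
theorem LocBound.eventually_le {R : TestFn n Y →ₗ[ℝ] ℝ} {i k : ℕ} {A : Set (Euc n)} {N δ : ℝ}
    (hR : LocBound R i (n + k) A N δ) (hN : 0 ≤ N) (hδ : 0 < δ) (hk : 0 < k) {a : Euc n}
    (haA : a ∈ A) (ha : IsDensityPt A a) {η : ℝ} (hη : 0 < η) :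
    ∀ᶠ r : ℝ in 𝓝[>] 0, ∀ φ ∈ unitTestFns (nu i (Metric.closedBall 0 1)),
      |R (rescale a r φ)| ≤ η * r ^ (n + k) := by
  have hs := one_le_cellRadius n
  have hv := cellVol_pos n
  have hc := cellConst_nonneg n i (n + k)
  set V := volume.real (Metric.closedBall (0 : Euc n) 1)
  set B := cellConst n i (n + k) * N * (3 * cellRadius n) ^ n * V / cellVol n with hBdef
  have hB : 0 ≤ B := by positivity
  -- `B` collects all constants of the final estimate, which will read `B * ε ^ k * r ^ (n + k)`.
  obtain ⟨ε, hε0, hε1, hεη⟩ : ∃ ε : ℝ, 0 < ε ∧ ε ≤ 1 ∧ B * ε ≤ η := by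
    refine ⟨min 1 (η / (B + 1)), by positivity, min_le_left _ _, ?_⟩
    calc B * min 1 (η / (B + 1)) ≤ (B + 1) * (η / (B + 1)) :=
          mul_le_mul (by linarith) (min_le_right _ _) (by positivity) (by positivity)
      _ = η := by field_simp
  filter_upwards [ha.eventually_infDist_le hε0, self_mem_nhdsWithin,
    Ioo_mem_nhdsGT (show 0 < δ / (9 * cellRadius n) by positivity)] with r hr hr0 hrδ φ hφ
  have hr0 : (0 : ℝ) < r := hr0
  have hsupp : tsupport (rescale a r φ) ⊆ Metric.closedBall a r := by
    simpa using tsupport_rescale_subset a hr0 hφ.1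
  have hbd : ScaledBoundOn i r 1 (rescale a r φ) Set.univ := by
    simpa using (scaledBoundOn_of_mem_unitTestFns hφ).rescale a hr0
  have hεr : ε * r ≤ r := by nlinarith
  have hest := hR.sum_estimate ⟨a, haA⟩ hN (show 0 < ε * r by positivity) (by
      have := (lt_div_iff₀ (by positivity)).1 hrδ.2
      nlinarith) zero_le_one (hbd.mono_scale (by positivity) hεr) (fun x hx => by
      have := hr x (hsupp (subset_tsupport _ hx))
      have h0 : 0 < ε * r := by positivity
      nlinarith) (S := Metric.closedBall a (3 * cellRadius n * r)) measure_closedBall_lt_top.ne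
    (fun x hx => by
      refine Metric.closedBall_subset_closedBall' ?_
      have := Metric.mem_closedBall.1 (hsupp (subset_tsupport _ hx))
      nlinarith [mul_le_mul_of_nonneg_left hεr (show 0 ≤ cellRadius n + 1 / 2 by linarith)])
  rw [volume_real_closedBall a (by positivity), mul_one] at hest
  have hεn : 0 < (ε * r) ^ n * cellVol n := by positivity
  rw [← le_div_iff₀ hεn] at hest
  refine hest.trans ?_
  -- The only use of `k > 0`: the surplus power of the mesh provides the smallness.
  have hεk : ε ^ k ≤ ε := pow_le_of_le_one hε0.le hε1 hk.ne'
  calc cellConst n i (n + k) * N * (ε * r) ^ (n + k) * ((3 * cellRadius n * r) ^ n * V) /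
        ((ε * r) ^ n * cellVol n) = B * ε ^ k * r ^ (n + k) := by
        rw [hBdef, pow_add, pow_add, mul_pow _ _ n, mul_pow _ _ k, mul_pow _ r n]
        field_simp
    _ ≤ B * ε * r ^ (n + k) := by gcongr
    _ ≤ η * r ^ (n + k) := by gcongr

end Rescaling

/-! ### Cutoffs near a set, and the rings between consecutive scales. -/

section Cutoff

variable {n : ℕ}

/-- A smooth function equal to `1` near `A` and supported near `A`, both at scale `ε`. -/
def cutoff (A : Set (Euc n)) (ε : ℝ) (x : Euc n) : ℝ :=
  ∑ z ∈ cellsNear A ε (5 * cellRadius n * ε), cellFn ε z x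

theorem contDiff_cutoff (A : Set (Euc n)) (ε : ℝ) : ContDiff ℝ ∞ (cutoff A ε) :=
  ContDiff.sum fun z _ => contDiff_cellFn ε z

theorem cutoff_eq_one {A : Set (Euc n)} (hb : Bornology.IsBounded A) (hA : A.Nonempty) {ε : ℝ}
    (hε : 0 < ε) {x : Euc n} (hx : Metric.infDist x A ≤ 4 * cellRadius n * ε) :
    cutoff A ε x = 1 := by
  refine sum_cellFn_eq_one hε _ fun z hz => (mem_cellsNear hb hA hε _ z).2 ?_
  have := Metric.infDist_le_infDist_add_dist (s := A) (x := ε • latPt z) (y := x)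
  rw [dist_comm] at this
  linarith

theorem infDist_le_of_cutoff_ne_zero {A : Set (Euc n)} (hb : Bornology.IsBounded A)
    (hA : A.Nonempty) {ε : ℝ} (hε : 0 < ε) {x : Euc n} (hx : cutoff A ε x ≠ 0) :
    Metric.infDist x A ≤ 6 * cellRadius n * ε := by
  obtain ⟨z, hz, hzx⟩ := Finset.exists_ne_zero_of_sum_ne_zero hx
  have h1 := (mem_cellsNear hb hA hε _ z).1 hz
  have h2 := dist_le_of_cellFn_ne_zero hε hzx
  have := Metric.infDist_le_infDist_add_dist (s := A) (x := x) (y := ε • latPt z)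
  linarith

/-- A bound for the scaled derivatives of `cutoff A ε`. -/
def cutoffBound (n i : ℕ) : ℝ :=
  (cellRadius n + 1) ^ n * volume.real (Metric.closedBall (0 : Euc n) 1) / cellVol n * cellBound n i

theorem cutoffBound_nonneg (n i : ℕ) : 0 ≤ cutoffBound n i := by
  have := cellBound_nonneg n i
  have := cellRadius_pos n
  have := cellVol_pos n
  unfold cutoffBound
  positivity

/-- Only cells within `cellRadius n * ε` of `x` contribute, and a volume comparison bounds their
number independently of `A` and `ε`. -/
theorem scaledBoundOn_cutoff (A : Set (Euc n)) (i : ℕ) {ε : ℝ} (hε : 0 < ε) :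
    ScaledBoundOn i ε (cutoffBound n i) (cutoff A ε) Set.univ := by
  classical
  intro m hm x _
  have hs := cellRadius_pos n
  have hv := cellVol_pos n
  have hcB := cellBound_nonneg n i
  set T := cellsNear A ε (5 * cellRadius n * ε)
  set Tx := T.filter fun z => dist x (ε • latPt z) ≤ cellRadius n * ε
  have h1 : iteratedFDeriv ℝ m (cutoff A ε) x = ∑ z ∈ T, iteratedFDeriv ℝ m (cellFn ε z) x := by
    have := iteratedFDeriv_sum (𝕜 := ℝ) (i := m) (u := T) (f := fun z => cellFn (n := n) ε z)
      fun z _ => (contDiff_cellFn ε z).of_le (by exact_mod_cast le_top)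
    change iteratedFDeriv ℝ m (fun x => ∑ z ∈ T, cellFn ε z x) x = _
    rw [this, Finset.sum_apply]
  have h2 : ∑ z ∈ T, iteratedFDeriv ℝ m (cellFn ε z) x
      = ∑ z ∈ Tx, iteratedFDeriv ℝ m (cellFn ε z) x := by
    refine (Finset.sum_subset (Finset.filter_subset _ _) fun z hz hzx => ?_).symm
    by_contra h0
    exact hzx (Finset.mem_filter.2 ⟨hz, tsupport_cellFn_subset hε z
      (support_iteratedFDeriv_subset m h0)⟩)
  have hcard : Tx.card * (ε ^ n * cellVol n)
      ≤ volume.real (Metric.closedBall x ((cellRadius n + 1) * ε)) := by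
    refine card_mul_le_volume hε Tx measure_closedBall_lt_top.ne fun z hz => ?_
    have := (Finset.mem_filter.1 hz).2
    refine Metric.ball_subset_closedBall.trans (Metric.closedBall_subset_closedBall' ?_)
    rw [dist_comm]
    linarith
  rw [volume_real_closedBall _ (by positivity), mul_pow] at hcard
  have hcard' : (Tx.card : ℝ) ≤ (cellRadius n + 1) ^ n *
      volume.real (Metric.closedBall (0 : Euc n) 1) / cellVol n := by
    rw [le_div_iff₀ hv]
    have hεn : 0 < ε ^ n := by positivity
    nlinarith
  rw [h1, h2]
  calc ε ^ m * ‖∑ z ∈ Tx, iteratedFDeriv ℝ m (cellFn ε z) x‖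
      ≤ ε ^ m * ∑ z ∈ Tx, ‖iteratedFDeriv ℝ m (cellFn ε z) x‖ := by
        gcongr
        exact norm_sum_le _ _
    _ = ∑ z ∈ Tx, ε ^ m * ‖iteratedFDeriv ℝ m (cellFn ε z) x‖ := Finset.mul_sum _ _ _
    _ ≤ ∑ _z ∈ Tx, cellBound n i :=
        Finset.sum_le_sum fun z _ => scaledBoundOn_cellFn i hε z m hm x trivial
    _ = Tx.card * cellBound n i := by rw [Finset.sum_const, nsmul_eq_mul]
    _ ≤ cutoffBound n i := mul_le_mul_of_nonneg_right hcard' hcB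

/-- The difference of the cutoff functions of two consecutive scales. -/
def ringFn (A : Set (Euc n)) (ε : ℝ) (x : Euc n) : ℝ := cutoff A ε x - cutoff A (ε / 2) x

theorem contDiff_ringFn (A : Set (Euc n)) (ε : ℝ) : ContDiff ℝ ∞ (ringFn A ε) :=
  (contDiff_cutoff A ε).sub (contDiff_cutoff A (ε / 2))

/-- A bound for the scaled derivatives of `ringFn A ε`. -/
def ringBound (n i : ℕ) : ℝ := cutoffBound n i + 2 ^ i * cutoffBound n i

theorem ringBound_nonneg (n i : ℕ) : 0 ≤ ringBound n i := by
  have := cutoffBound_nonneg n i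
  unfold ringBound
  positivity

theorem scaledBoundOn_ringFn (A : Set (Euc n)) (i : ℕ) {ε : ℝ} (hε : 0 < ε) :
    ScaledBoundOn i ε (ringBound n i) (ringFn A ε) Set.univ := by
  intro m hm x _
  have h1 := scaledBoundOn_cutoff A i hε m hm x trivial
  have h2 := (scaledBoundOn_cutoff A i (half_pos hε)).mul_scale (cutoffBound_nonneg n i)
    one_le_two m hm x trivial
  rw [mul_div_cancel₀ ε two_ne_zero] at h2
  have h3 : iteratedFDeriv ℝ m (ringFn A ε) x
      = iteratedFDeriv ℝ m (cutoff A ε) x - iteratedFDeriv ℝ m (cutoff A (ε / 2)) x :=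
    iteratedFDeriv_sub_apply (f := cutoff A ε) (g := cutoff A (ε / 2))
      ((contDiff_cutoff A ε).contDiffAt.of_le (by exact_mod_cast le_top))
      ((contDiff_cutoff A (ε / 2)).contDiffAt.of_le (by exact_mod_cast le_top))
  rw [h3]
  calc ε ^ m * ‖iteratedFDeriv ℝ m (cutoff A ε) x - iteratedFDeriv ℝ m (cutoff A (ε / 2)) x‖
      ≤ ε ^ m * (‖iteratedFDeriv ℝ m (cutoff A ε) x‖
        + ‖iteratedFDeriv ℝ m (cutoff A (ε / 2)) x‖) := by
        gcongr
        exact norm_sub_le _ _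
    _ ≤ ringBound n i := by
        rw [mul_add]
        exact add_le_add h1 h2

/-- Both cutoffs equal `1` close to `A` and both vanish far from it, so they can differ only at
distances comparable to `ε`. -/
theorem infDist_of_ringFn_ne_zero {A : Set (Euc n)} (hb : Bornology.IsBounded A)
    (hA : A.Nonempty) {ε : ℝ} (hε : 0 < ε) {x : Euc n} (hx : ringFn A ε x ≠ 0) :
    2 * cellRadius n * ε ≤ Metric.infDist x A ∧ Metric.infDist x A ≤ 6 * cellRadius n * ε := by
  have hs := cellRadius_pos n
  have hsε : 0 < cellRadius n * ε := by positivity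
  constructor
  · by_contra h
    rw [not_le] at h
    apply hx
    rw [ringFn, cutoff_eq_one hb hA hε (by nlinarith),
      cutoff_eq_one hb hA (half_pos hε) (by nlinarith), sub_self]
  · by_contra h
    rw [not_le] at h
    have h1 : cutoff A ε x = 0 := by
      by_contra h0
      exact absurd (infDist_le_of_cutoff_ne_zero hb hA hε h0) (not_le.2 h)
    have h2 : cutoff A (ε / 2) x = 0 := by
      by_contra h0
      have := infDist_le_of_cutoff_ne_zero hb hA (half_pos hε) h0
      nlinarith
    exact hx (by rw [ringFn, h1, h2, sub_self])

/-- The points whose distance to `A` is comparable to `ε`. -/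
def ringSet (A : Set (Euc n)) (ε : ℝ) : Set (Euc n) :=
  {x | ε / 2 ≤ Metric.infDist x A ∧ Metric.infDist x A ≤ 8 * cellRadius n * ε}

theorem measurableSet_ringSet (A : Set (Euc n)) (ε : ℝ) : MeasurableSet (ringSet A ε) :=
  (measurableSet_le measurable_const (Metric.continuous_infDist_pt A).measurable).inter
    (measurableSet_le (Metric.continuous_infDist_pt A).measurable measurable_const)

theorem ringSet_subset_compl_closure {A : Set (Euc n)} {ε : ℝ} (hε : 0 < ε) :
    ringSet A ε ⊆ (closure A)ᶜ := by
  intro x hx hxA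
  have h := hx.1
  rw [Metric.infDist_zero_of_mem_closure hxA] at h
  linarith

/-- The factors `1 / 2` and `8` in `ringSet` leave room, around the support of `ringFn`, for the
counting balls of `LocBound.sum_estimate`. -/
theorem closedBall_subset_ringSet {A : Set (Euc n)} (hb : Bornology.IsBounded A)
    (hA : A.Nonempty) {ε : ℝ} (hε : 0 < ε) {x : Euc n} (hx : ringFn A ε x ≠ 0) :
    Metric.closedBall x ((cellRadius n + 1 / 2) * ε) ⊆ ringSet A ε := by
  intro y hy
  have hs := one_le_cellRadius n
  have hsε : ε ≤ cellRadius n * ε := by nlinarith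
  obtain ⟨h1, h2⟩ := infDist_of_ringFn_ne_zero hb hA hε hx
  have hy' := Metric.mem_closedBall.1 hy
  have h3 := Metric.infDist_le_infDist_add_dist (s := A) (x := y) (y := x)
  have h4 := Metric.infDist_le_infDist_add_dist (s := A) (x := x) (y := y)
  rw [dist_comm] at h4
  constructor <;> linarith

/-- Integrate the multiplicity function, which is at most `L` and vanishes outside `W`. -/
theorem sum_measure_le_of_card_le {α ι : Type*} [MeasurableSpace α] (μ : Measure α) (T : Finset ι)
    (S : ι → Set α) (W : Set α) (L : ℕ) (hmeas : ∀ j ∈ T, MeasurableSet (S j))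
    (hsub : ∀ j ∈ T, S j ⊆ W) (hcard : ∀ x, ∀ T' ⊆ T, (∀ j ∈ T', x ∈ S j) → T'.card ≤ L) :
    ∑ j ∈ T, μ (S j) ≤ L * μ W := by
  classical
  calc ∑ j ∈ T, μ (S j) = ∑ j ∈ T, ∫⁻ x, (S j).indicator 1 x ∂μ :=
        Finset.sum_congr rfl fun j hj => (lintegral_indicator_one (hmeas j hj)).symm
    _ = ∫⁻ x, ∑ j ∈ T, (S j).indicator 1 x ∂μ :=
        (lintegral_finsetSum' _ fun j hj =>
          (measurable_one.indicator (hmeas j hj)).aemeasurable).symm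
    _ ≤ ∫⁻ x, W.indicator (fun _ => (L : ENNReal)) x ∂μ := by
        refine lintegral_mono fun x => ?_
        have h1 : ∑ j ∈ T, (S j).indicator (1 : α → ENNReal) x
            = ((T.filter fun j => x ∈ S j).card : ENNReal) := by
          simp [Set.indicator_apply]
        change ∑ j ∈ T, (S j).indicator (1 : α → ENNReal) x ≤ _
        rw [h1]
        by_cases hx : x ∈ W
        · rw [Set.indicator_of_mem hx]
          exact_mod_cast hcard x _ (Finset.filter_subset _ _) fun j hj =>
            (Finset.mem_filter.1 hj).2
        · have : T.filter (fun j => x ∈ S j) = ∅ :=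
            Finset.filter_eq_empty_iff.2 fun j hj hxj => hx (hsub j hj hxj)
          simp [this]
    _ ≤ L * μ W := lintegral_indicator_const_le _ _

/-- A bound for the number of sets `ringSet A (2⁻¹ ^ l)` which contain a given point. -/
def ringOverlap (n : ℕ) : ℕ := Nat.clog 2 ⌈16 * cellRadius n⌉₊ + 1

/-- If a point lies in the rings of scales `2⁻¹ ^ l₀` and `2⁻¹ ^ (l₀ + d)`, then `2 ^ d ≤ 16 *
cellRadius n`. So the overlap is bounded, and all rings avoid the closure of `A`. -/
theorem sum_volume_ringSet_le (A : Set (Euc n)) (T : Finset ℕ) {W : Set (Euc n)}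
    (hWm : MeasurableSet W) (hW : volume W ≠ ⊤) :
    ∑ l ∈ T, volume.real (ringSet A (2⁻¹ ^ l) ∩ W)
      ≤ ringOverlap n * volume.real ((closure A)ᶜ ∩ W) := by
  have hs := cellRadius_pos n
  have hfin : ∀ S : Set (Euc n), volume (S ∩ W) ≠ ⊤ := fun S =>
    measure_ne_top_of_subset Set.inter_subset_right hW
  have hL : 16 * cellRadius n ≤ (2 : ℝ) ^ (ringOverlap n - 1) := by
    have h1 : ⌈16 * cellRadius n⌉₊ ≤ 2 ^ (ringOverlap n - 1) := by
      simpa [ringOverlap] using Nat.le_pow_clog one_lt_two ⌈16 * cellRadius n⌉₊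
    exact (Nat.le_ceil _).trans (by exact_mod_cast h1)
  have key := sum_measure_le_of_card_le (volume : Measure (Euc n)) T
    (fun l => ringSet A (2⁻¹ ^ l) ∩ W) ((closure A)ᶜ ∩ W) (ringOverlap n)
    (fun l _ => (measurableSet_ringSet A _).inter hWm)
    (fun l _ => Set.inter_subset_inter_left _ (ringSet_subset_compl_closure (by positivity)))
    (fun x T' _ hT' => by
      rcases T'.eq_empty_or_nonempty with rfl | hne
      · simp
      · set l₀ := T'.min' hne
        have hl₀ := (hT' l₀ (T'.min'_mem hne)).1
        have hsub : T' ⊆ Finset.Ico l₀ (l₀ + ringOverlap n) := by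
          intro l hl
          have hle : l₀ ≤ l := T'.min'_le l hl
          refine Finset.mem_Ico.2 ⟨hle, ?_⟩
          have h1 := hl₀.1.trans (hT' l hl).1.2
          obtain ⟨d, rfl⟩ := Nat.exists_eq_add_of_le hle
          have h2 : (2 : ℝ) ^ d ≤ 16 * cellRadius n := by
            rw [pow_add] at h1
            have hp : (0 : ℝ) < 2⁻¹ ^ l₀ := by positivity
            have h3 : (1 : ℝ) ≤ 16 * cellRadius n * 2⁻¹ ^ d := by nlinarith
            rw [inv_pow, ← div_eq_mul_inv, one_le_div (by positivity)] at h3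
            exact h3
          have h3 := (pow_le_pow_iff_right₀ (one_lt_two (α := ℝ))).1 (h2.trans hL)
          have : 1 ≤ ringOverlap n := by simp [ringOverlap]
          omega
        simpa using Finset.card_le_card hsub)
  have h2 := ENNReal.toReal_mono (ENNReal.mul_ne_top (ENNReal.natCast_ne_top _) (hfin _)) key
  rw [ENNReal.toReal_sum fun l _ => hfin _, ENNReal.toReal_mul, ENNReal.toReal_natCast] at h2
  exact h2

end Cutoff

/-! ### The limit of the cutoff values for order zero. -/

section Limit

variable {n : ℕ} {Y : Type*} [NormedAddCommGroup Y] [NormedSpace ℝ Y]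

/-- The constant in `LocBound.ring_estimate`. -/
def ringConst (n i : ℕ) : ℝ := cellConst n i n * (2 ^ i * ringBound n i) / cellVol n

theorem ringConst_nonneg (n i : ℕ) : 0 ≤ ringConst n i := by
  have := ringBound_nonneg n i
  have := cellConst_nonneg n i n
  have := cellVol_pos n
  unfold ringConst
  positivity

/-- With exponent exactly `n`, the factor `ε ^ n` of the cell estimates cancels the one from
counting, and only the volume of the ring remains. -/
theorem LocBound.ring_estimate {R : TestFn n Y →ₗ[ℝ] ℝ} {i : ℕ} {A : Set (Euc n)} {N δ : ℝ}
    (hR : LocBound R i n A N δ) (hb : Bornology.IsBounded A) (hA : A.Nonempty) (hN : 0 ≤ N)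
    {ε : ℝ} (hε : 0 < ε) (hεδ : 9 * cellRadius n * ε < δ) {φ : TestFn n Y} {M : ℝ} (hM : 0 ≤ M)
    (hφ : ScaledBoundOn i ε M φ Set.univ) {W : Set (Euc n)} (hW : volume W ≠ ⊤)
    (hφW : ∀ x, φ x ≠ 0 → Metric.closedBall x ((cellRadius n + 1 / 2) * ε) ⊆ W) :
    |R (mulTest (cutoff A ε) (contDiff_cutoff A ε) φ)
      - R (mulTest (cutoff A (ε / 2)) (contDiff_cutoff A (ε / 2)) φ)|
      ≤ ringConst n i * N * M * volume.real (ringSet A ε ∩ W) := by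
  have hv := cellVol_pos n
  have hB := ringBound_nonneg n i
  have hdiff : mulTest (cutoff A ε) (contDiff_cutoff A ε) φ
      - mulTest (cutoff A (ε / 2)) (contDiff_cutoff A (ε / 2)) φ
      = mulTest (ringFn A ε) (contDiff_ringFn A ε) φ := by
    ext x
    change cutoff A ε x • φ x - cutoff A (ε / 2) x • φ x = ringFn A ε x • φ x
    rw [ringFn, sub_smul]
  rw [← map_sub, hdiff]
  have hne : ∀ x, mulTest (ringFn A ε) (contDiff_ringFn A ε) φ x ≠ 0 →
      ringFn A ε x ≠ 0 ∧ φ x ≠ 0 := fun x hx => smul_ne_zero_iff.1 hx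
  have h := hR.sum_estimate hA hN hε hεδ (M := 2 ^ i * (ringBound n i * M)) (by positivity)
    (φ := mulTest (ringFn A ε) (contDiff_ringFn A ε) φ)
    (ScaledBoundOn.smul (contDiff_ringFn A ε) φ.contDiff hε.le hB hM
      (scaledBoundOn_ringFn A i hε) hφ)
    (fun x hx => (infDist_of_ringFn_ne_zero hb hA hε (hne x hx).1).2)
    (measure_ne_top_of_subset (Set.inter_subset_right (s := ringSet A ε)) hW)
    (fun x hx => Set.subset_inter (closedBall_subset_ringSet hb hA hε (hne x hx).1)
      (hφW x (hne x hx).2))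
  have hεn : 0 < ε ^ n := by positivity
  rw [← le_div_iff₀ (by positivity)] at h
  refine h.trans (le_of_eq ?_)
  unfold ringConst
  field_simp

/-- The value of `R` at the product of `φ` with the cutoff function of scale `2⁻¹ ^ l`. -/
def cutoffSeq (R : TestFn n Y →ₗ[ℝ] ℝ) (A : Set (Euc n)) (φ : TestFn n Y) (l : ℕ) : ℝ :=
  R (mulTest (cutoff A (2⁻¹ ^ l)) (contDiff_cutoff A (2⁻¹ ^ l)) φ)

/-- The total variation of the cutoff values from stage `J` on is controlled by the volume outside
the closure. This single bound yields both convergence and, on small balls at density points,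
smallness. -/
theorem LocBound.sum_cutoffSeq_le {R : TestFn n Y →ₗ[ℝ] ℝ} {i : ℕ} {A : Set (Euc n)} {N δ : ℝ}
    (hR : LocBound R i n A N δ) (hb : Bornology.IsBounded A) (hA : A.Nonempty) (hN : 0 ≤ N)
    {J : ℕ} (hJ : 9 * cellRadius n * 2⁻¹ ^ J < δ) {φ : TestFn n Y} {M : ℝ} (hM : 0 ≤ M)
    (hφ : ScaledBoundOn i (2⁻¹ ^ J) M φ Set.univ) {W : Set (Euc n)} (hWm : MeasurableSet W)
    (hW : volume W ≠ ⊤)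
    (hφW : ∀ x, φ x ≠ 0 → Metric.closedBall x ((cellRadius n + 1 / 2) * 2⁻¹ ^ J) ⊆ W) (m : ℕ) :
    ∑ l ∈ Finset.range m, |cutoffSeq R A φ (J + l) - cutoffSeq R A φ (J + (l + 1))|
      ≤ ringConst n i * N * M * (ringOverlap n * volume.real ((closure A)ᶜ ∩ W)) := by
  have hs := cellRadius_pos n
  have hc := ringConst_nonneg n i
  have h1 : ∀ l, |cutoffSeq R A φ (J + l) - cutoffSeq R A φ (J + (l + 1))|
      ≤ ringConst n i * N * M * volume.real (ringSet A (2⁻¹ ^ (J + l)) ∩ W) := by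
    intro l
    have hle : (2⁻¹ : ℝ) ^ (J + l) ≤ 2⁻¹ ^ J :=
      pow_le_pow_of_le_one (by norm_num) (by norm_num) (Nat.le_add_right _ _)
    have h := hR.ring_estimate hb hA hN (show (0 : ℝ) < 2⁻¹ ^ (J + l) by positivity)
      (lt_of_le_of_lt (by gcongr) hJ) hM (hφ.mono_scale (by positivity) hle) hW
      (fun x hx => (Metric.closedBall_subset_closedBall (by gcongr)).trans (hφW x hx))
    have hhalf : (2⁻¹ : ℝ) ^ (J + l) / 2 = 2⁻¹ ^ (J + (l + 1)) := by
      rw [← add_assoc, pow_succ, div_eq_mul_inv]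
    unfold cutoffSeq
    simp only [hhalf] at h
    exact h
  refine (Finset.sum_le_sum fun l _ => h1 l).trans ?_
  rw [← Finset.mul_sum]
  refine mul_le_mul_of_nonneg_left ?_ (by positivity)
  have := sum_volume_ringSet_le A ((Finset.range m).map (addLeftEmbedding J)) hWm hW
  rwa [Finset.sum_map] at this

theorem exists_mesh_lt {c : ℝ} (hc : 0 < c) : ∃ J : ℕ, 9 * cellRadius n * 2⁻¹ ^ J < c := by
  have hs := cellRadius_pos n
  obtain ⟨J, hJ⟩ := exists_pow_lt_of_lt_one (show 0 < c / (9 * cellRadius n) by positivity)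
    (show (2⁻¹ : ℝ) < 1 by norm_num)
  refine ⟨J, ?_⟩
  rw [lt_div_iff₀ (by positivity)] at hJ
  linarith

theorem LocBound.exists_tendsto_cutoffSeq {R : TestFn n Y →ₗ[ℝ] ℝ} {i : ℕ} {A : Set (Euc n)}
    {N δ : ℝ} (hR : LocBound R i n A N δ) (hb : Bornology.IsBounded A) (hA : A.Nonempty)
    (hN : 0 ≤ N) (hδ : 0 < δ) (φ : TestFn n Y) :
    ∃ c, Tendsto (cutoffSeq R A φ) atTop (𝓝 c) := by
  obtain ⟨J, hJ⟩ := exists_mesh_lt (n := n) hδ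
  obtain ⟨ρ, hρ⟩ := φ.hasCompactSupport.isCompact.isBounded.subset_closedBall 0
  obtain ⟨M, hM0, hM⟩ := exists_scaledBoundOn_univ φ.contDiff φ.hasCompactSupport i
  have hJ1 : (2⁻¹ : ℝ) ^ J ≤ 1 := pow_le_one₀ (by norm_num) (by norm_num)
  have hsum := hR.sum_cutoffSeq_le hb hA hN hJ hM0 (hM.mono_scale (by positivity) hJ1)
    (W := Metric.closedBall 0 (ρ + (cellRadius n + 1 / 2) * 2⁻¹ ^ J)) measurableSet_closedBall
    measure_closedBall_lt_top.ne fun x hx => Metric.closedBall_subset_closedBall' (by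
      have := Metric.mem_closedBall.1 (hρ (subset_tsupport _ hx))
      linarith)
  have hS : Summable fun l => |cutoffSeq R A φ (J + l) - cutoffSeq R A φ (J + (l + 1))| :=
    summable_of_sum_range_le (fun _ => abs_nonneg _) hsum
  have hC : CauchySeq fun l => cutoffSeq R A φ (J + l) := cauchySeq_of_summable_dist hS
  obtain ⟨c, hc⟩ := cauchySeq_tendsto_of_complete hC
  refine ⟨c, (tendsto_add_atTop_iff_nat J).1 ?_⟩
  simpa only [add_comm] using hc

theorem LocBound.exists_limit {R : TestFn n Y →ₗ[ℝ] ℝ} {i : ℕ} {A : Set (Euc n)}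
    {N δ : ℝ} (hR : LocBound R i n A N δ) (hb : Bornology.IsBounded A) (hA : A.Nonempty)
    (hN : 0 ≤ N) (hδ : 0 < δ) : ∃ Λ : TestFn n Y →ₗ[ℝ] ℝ, ∀ φ,
      Tendsto (cutoffSeq R A φ) atTop (𝓝 (Λ φ)) := by
  choose Λ hΛ using hR.exists_tendsto_cutoffSeq hb hA hN hδ
  refine ⟨⟨⟨Λ, fun φ ψ => ?_⟩, fun c φ => ?_⟩, hΛ⟩
  · refine tendsto_nhds_unique (hΛ _) (((hΛ φ).add (hΛ ψ)).congr fun l => ?_)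
    unfold cutoffSeq
    rw [← map_add]
    congr 1
    ext x
    exact (smul_add _ _ _).symm
  · refine tendsto_nhds_unique (hΛ _) (((hΛ φ).const_mul c).congr fun l => ?_)
    unfold cutoffSeq
    rw [← smul_eq_mul, ← map_smul]
    congr 1
    ext x
    exact smul_comm _ _ _

/-- Start the cutoff sequence at a scale comparable to `r`: there the cutoff is `1` on the support,
so the first value is `R (rescale a r φ)` itself. The remaining variation is a multiple of the
volume missing from a ball of radius comparable to `r`, which is `o(r ^ n)`. -/
theorem LocBound.eventually_sub_le {R Λ : TestFn n Y →ₗ[ℝ] ℝ} {i : ℕ} {A : Set (Euc n)}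
    {N δ : ℝ} (hR : LocBound R i n A N δ) (hb : Bornology.IsBounded A)
    (hN : 0 ≤ N) (hδ : 0 < δ) (hΛ : ∀ φ, Tendsto (cutoffSeq R A φ) atTop (𝓝 (Λ φ))) {a : Euc n}
    (haA : a ∈ A) (ha : IsDensityPt A a) {η : ℝ} (hη : 0 < η) :
    ∀ᶠ r : ℝ in 𝓝[>] 0, ∀ φ ∈ unitTestFns (nu i (Metric.closedBall 0 1)),
      |R (rescale a r φ) - Λ (rescale a r φ)| ≤ η * r ^ n := by
  have hs := one_le_cellRadius n
  have hc := ringConst_nonneg n i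
  set K := ringConst n i * N * 1 * ringOverlap n with hK
  have hK0 : 0 ≤ K := by positivity
  filter_upwards [ha.eventually_volume_le (show 0 < 3 * cellRadius n by positivity)
    (show 0 < η / (K + 1) by positivity), self_mem_nhdsWithin,
    Ioo_mem_nhdsGT (show 0 < min 1 (δ / (9 * cellRadius n)) by positivity)] with r hr hr0 hrδ φ hφ
  have hr0 : (0 : ℝ) < r := hr0
  have hr1 : r ≤ 1 := hrδ.2.le.trans (min_le_left _ _)
  -- This gives `2⁻¹ ^ (J + 1) < r ≤ 2⁻¹ ^ J`: stage `J + 1` is fine enough for the derivative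
  -- bounds at scale `r` and coarse enough for the cutoff to be `1` within distance `r` of `a`.
  obtain ⟨J, hJ1, hJ2⟩ := exists_nat_pow_near_of_lt_one hr0 hr1 (show (0 : ℝ) < 2⁻¹ by norm_num)
    (show (2⁻¹ : ℝ) < 1 by norm_num)
  have hJ3 : r ≤ 2 * 2⁻¹ ^ (J + 1) := by
    rw [pow_succ]
    linarith
  have hsupp : tsupport (rescale a r φ) ⊆ Metric.closedBall a r := by
    simpa using tsupport_rescale_subset a hr0 hφ.1
  have hbd : ScaledBoundOn i r 1 (rescale a r φ) Set.univ := by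
    simpa using (scaledBoundOn_of_mem_unitTestFns hφ).rescale a hr0
  have hp : (0 : ℝ) < 2⁻¹ ^ (J + 1) := by positivity
  have h0 : cutoffSeq R A (rescale a r φ) (J + 1) = R (rescale a r φ) := by
    unfold cutoffSeq
    congr 1
    ext x
    rw [mulTest_apply]
    by_cases hx : rescale a r φ x = 0
    · rw [hx, smul_zero]
    · rw [cutoff_eq_one hb ⟨a, haA⟩ hp, one_smul]
      have h1 := Metric.infDist_le_dist_of_mem (x := x) haA
      have h2 := Metric.mem_closedBall.1 (hsupp (subset_tsupport _ hx))
      nlinarith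
  have hsum := hR.sum_cutoffSeq_le hb ⟨a, haA⟩ hN (J := J + 1) (by
      have := (lt_div_iff₀ (by positivity)).1 (hrδ.2.trans_le (min_le_right _ _))
      nlinarith) zero_le_one (hbd.mono_scale hp.le hJ1.le)
    (W := Metric.closedBall a (3 * cellRadius n * r)) measurableSet_closedBall
    measure_closedBall_lt_top.ne fun x hx => Metric.closedBall_subset_closedBall' (by
      have := Metric.mem_closedBall.1 (hsupp (subset_tsupport _ hx))
      nlinarith)
  have hbound : ∀ m, |R (rescale a r φ) - cutoffSeq R A (rescale a r φ) (J + 1 + m)|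
      ≤ η * r ^ n := by
    intro m
    rw [← h0]
    have h1 := dist_le_range_sum_dist (fun l => cutoffSeq R A (rescale a r φ) (J + 1 + l)) m
    refine (h1.trans (hsum m)).trans ?_
    calc ringConst n i * N * 1 * (ringOverlap n *
          volume.real ((closure A)ᶜ ∩ Metric.closedBall a (3 * cellRadius n * r)))
        = K * volume.real ((closure A)ᶜ ∩ Metric.closedBall a (3 * cellRadius n * r)) := by
          rw [hK]; ring
      _ ≤ K * (η / (K + 1) * r ^ n) := mul_le_mul_of_nonneg_left hr hK0
      _ ≤ (K + 1) * (η / (K + 1) * r ^ n) :=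
          mul_le_mul_of_nonneg_right (by linarith) (by positivity)
      _ = η * r ^ n := by field_simp
  have hlim : Tendsto (fun m => |R (rescale a r φ) - cutoffSeq R A (rescale a r φ) (J + 1 + m)|)
      atTop (𝓝 |R (rescale a r φ) - Λ (rescale a r φ)|) := by
    have := (tendsto_add_atTop_iff_nat (J + 1)).2 (hΛ (rescale a r φ))
    simp only [add_comm _ (J + 1)] at this
    exact (this.const_sub _).abs
  exact le_of_tendsto' hlim hbound

end Limit

/-! ### The limit functional is bounded by an integral norm. -/

section IntegralBound

variable {n : ℕ} {Y : Type*} [NormedAddCommGroup Y] [NormedSpace ℝ Y]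

theorem testFn_integrable (φ : TestFn n Y) : Integrable φ :=
  φ.continuous.integrable_of_hasCompactSupport φ.hasCompactSupport

theorem norm_sub_le_of_scaledBoundOn {i : ℕ} {M : ℝ} {φ : TestFn n Y}
    (h : ScaledBoundOn (i + 1) 1 M φ Set.univ) (x y : Euc n) : ‖φ x - φ y‖ ≤ M * ‖x - y‖ := by
  refine convex_univ.norm_image_sub_le_of_norm_fderiv_le (𝕜 := ℝ)
    (fun z _ => (φ.contDiff.differentiable (by simp)).differentiableAt) (fun z _ => ?_)
    (Set.mem_univ y) (Set.mem_univ x)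
  have := h 1 (by omega) z trivial
  rwa [one_pow, one_mul, norm_iteratedFDeriv_one] at this

/-- On a ball of size `ε` a fixed test function is nearly constant: its oscillation and its weighted
higher derivatives are `O(ε)`. One derivative beyond `i` is assumed so that a Lipschitz bound is
available even for `i = 0`. -/
theorem scaledBoundOn_closedBall {i : ℕ} {M ε ρ : ℝ} {φ : TestFn n Y} (hε : 0 < ε) (hε1 : ε ≤ 1)
    (hρ : 1 ≤ ρ) (hM : 0 ≤ M) (h : ScaledBoundOn (i + 1) 1 M φ Set.univ) {c y : Euc n}
    (hy : y ∈ Metric.closedBall c (ρ * ε)) :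
    ScaledBoundOn i ε (‖φ y‖ + 2 * ρ * M * ε) φ (Metric.closedBall c (ρ * ε)) := by
  have hMε : 0 ≤ M * ε := by positivity
  intro m hm x hx
  rcases Nat.eq_zero_or_pos m with rfl | hm0
  · rw [pow_zero, one_mul, norm_iteratedFDeriv_zero]
    have h1 := norm_sub_le_of_scaledBoundOn h x y
    have h2 := norm_le_norm_add_norm_sub' (φ x) (φ y)
    have h3 : ‖x - y‖ ≤ 2 * ρ * ε := by
      rw [← dist_eq_norm]
      have := dist_triangle_right x y c
      have := Metric.mem_closedBall.1 hx
      have := Metric.mem_closedBall.1 hy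
      linarith
    have h4 : M * ‖x - y‖ ≤ M * (2 * ρ * ε) := mul_le_mul_of_nonneg_left h3 hM
    linarith
  · have h1 := h m (by omega) x trivial
    rw [one_pow, one_mul] at h1
    have h2 : ε ^ m ≤ ε := pow_le_of_le_one hε.le hε1 hm0.ne'
    calc ε ^ m * ‖iteratedFDeriv ℝ m φ x‖ ≤ ε * M :=
          mul_le_mul h2 h1 (norm_nonneg _) hε.le
      _ ≤ ‖φ y‖ + 2 * ρ * M * ε := by
          have := norm_nonneg (φ y)
          nlinarith

/-- The cell estimate holds with `‖φ y‖` for every `y` in the counting ball, so it may be averaged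
over that ball, turning a supremum into an integral. -/
theorem LocBound.cell_integral_estimate {R : TestFn n Y →ₗ[ℝ] ℝ} {i : ℕ} {A : Set (Euc n)}
    {N δ : ℝ} (hR : LocBound R i n A N δ) (hA : A.Nonempty) {ε : ℝ} (hε : 0 < ε)
    (hε1 : ε ≤ 1) (hεδ : 9 * cellRadius n * ε < δ) {z : Fin n → ℤ}
    (hz : Metric.infDist (ε • latPt z) A ≤ 7 * cellRadius n * ε) {φ : TestFn n Y} {M : ℝ}
    (hM : 0 ≤ M) (h : ScaledBoundOn (i + 1) 1 M φ Set.univ) :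
    |R (mulTest (cellFn ε z) (contDiff_cellFn ε z) φ)| * cellVol n ≤ cellConst n i n * N *
      ∫ y in Metric.ball (ε • latPt z) (ε / 2), (‖φ y‖ + 2 * cellRadius n * M * ε) := by
  have hs := one_le_cellRadius n
  have hc := cellConst_nonneg n i n
  have hεn : 0 < ε ^ n := by positivity
  set B := Metric.ball (ε • latPt z) (ε / 2)
  have hint : IntegrableOn (fun y => ‖φ y‖ + 2 * cellRadius n * M * ε) B :=
    (testFn_integrable φ).norm.integrableOn.add (integrableOn_const measure_ball_lt_top.ne)
  have h1 : ∀ y ∈ B, |R (mulTest (cellFn ε z) (contDiff_cellFn ε z) φ)|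
      ≤ cellConst n i n * N * ε ^ n * (‖φ y‖ + 2 * cellRadius n * M * ε) := by
    intro y hy
    have hy' : y ∈ Metric.closedBall (ε • latPt z) (cellRadius n * ε) :=
      Metric.ball_subset_closedBall.trans (Metric.closedBall_subset_closedBall (by nlinarith)) hy
    refine (hR.cell_estimate hA hε hεδ hz (by positivity)
      (scaledBoundOn_closedBall hε hε1 hs hM h hy')).trans (le_of_eq (by ring))
  have h2 : ∫ _y in B, |R (mulTest (cellFn ε z) (contDiff_cellFn ε z) φ)|
      ≤ ∫ y in B, cellConst n i n * N * ε ^ n * (‖φ y‖ + 2 * cellRadius n * M * ε) :=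
    setIntegral_mono_on (integrableOn_const measure_ball_lt_top.ne) (hint.const_mul _)
      measurableSet_ball h1
  rw [setIntegral_const, volume_real_ball_half _ hε, integral_const_mul, smul_eq_mul] at h2
  refine le_of_mul_le_mul_left ?_ hεn
  linarith

/-- The limit functional is bounded by the integral norm over a bounded set. -/
theorem LocBound.limit_le {R Λ : TestFn n Y →ₗ[ℝ] ℝ} {i : ℕ} {A : Set (Euc n)}
    {N δ : ℝ} (hR : LocBound R i n A N δ) (hb : Bornology.IsBounded A) (hA : A.Nonempty)
    (hN : 0 ≤ N) (hδ : 0 < δ) (hΛ : ∀ φ, Tendsto (cutoffSeq R A φ) atTop (𝓝 (Λ φ))) :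
    ∃ (ρ C : ℝ), 0 ≤ C ∧ ∀ φ, |Λ φ| ≤ C * ∫ x in Metric.closedBall 0 ρ, ‖φ x‖ := by
  have hs := one_le_cellRadius n
  have hc := cellConst_nonneg n i n
  have hv := cellVol_pos n
  obtain ⟨J, hJ⟩ := exists_mesh_lt (n := n) hδ
  obtain ⟨ρ₀, hρ₀⟩ := hb.subset_closedBall 0
  set ρ := ρ₀ + 8 * cellRadius n
  set B := Metric.closedBall (0 : Euc n) ρ
  refine ⟨ρ, cellConst n i n * N / cellVol n, by positivity, fun φ => ?_⟩
  obtain ⟨M, hM0, hM⟩ := exists_scaledBoundOn_univ φ.contDiff φ.hasCompactSupport (i + 1)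
  have hφint := (testFn_integrable φ).norm
  -- The counting balls are disjoint, so the cell integrals add up to an integral over `B`; the
  -- error term carries a factor `2⁻¹ ^ l` and disappears in the limit.
  have hest : ∀ l, J ≤ l → |cutoffSeq R A φ l| * cellVol n ≤ cellConst n i n * N *
      ((∫ x in B, ‖φ x‖) + 2 * cellRadius n * M * 2⁻¹ ^ l * volume.real B) := by
    intro l hl
    set ε : ℝ := 2⁻¹ ^ l
    have hε : 0 < ε := by positivity
    have hε1 : ε ≤ 1 := pow_le_one₀ (by norm_num) (by norm_num)
    have hεJ : ε ≤ 2⁻¹ ^ J := pow_le_pow_of_le_one (by norm_num) (by norm_num) hl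
    set T := cellsNear A ε (5 * cellRadius n * ε)
    have hTz : ∀ z ∈ T, Metric.infDist (ε • latPt z) A ≤ 5 * cellRadius n * ε :=
      fun z hz => (mem_cellsNear hb hA hε _ z).1 hz
    have hsum : cutoffSeq R A φ l
        = ∑ z ∈ T, R (mulTest (cellFn ε z) (contDiff_cellFn ε z) φ) := by
      rw [← map_sum]
      unfold cutoffSeq
      congr 1
      ext x
      rw [testFn_sum_apply, mulTest_apply, cutoff, Finset.sum_smul]
      rfl
    have hint : IntegrableOn (fun y => ‖φ y‖ + 2 * cellRadius n * M * ε) B :=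
      hφint.integrableOn.add (integrableOn_const measure_closedBall_lt_top.ne)
    have hsubB : ∀ z ∈ T, Metric.ball (ε • latPt z) (ε / 2) ⊆ B := by
      intro z hz
      obtain ⟨y, hy, hyz⟩ := (Metric.infDist_lt_iff hA).1
        ((hTz z hz).trans_lt (show _ < 6 * cellRadius n * ε by nlinarith))
      refine Metric.ball_subset_closedBall.trans (Metric.closedBall_subset_closedBall' ?_)
      have h1 := Metric.mem_closedBall.1 (hρ₀ hy)
      have h2 := dist_triangle (ε • latPt z) y 0
      have h3 : cellRadius n * ε ≤ cellRadius n := by nlinarith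
      simp only [ρ]
      nlinarith
    rw [hsum]
    calc |∑ z ∈ T, R (mulTest (cellFn ε z) (contDiff_cellFn ε z) φ)| * cellVol n
        ≤ (∑ z ∈ T, |R (mulTest (cellFn ε z) (contDiff_cellFn ε z) φ)|) * cellVol n :=
          mul_le_mul_of_nonneg_right (Finset.abs_sum_le_sum_abs _ _) hv.le
      _ = ∑ z ∈ T, |R (mulTest (cellFn ε z) (contDiff_cellFn ε z) φ)| * cellVol n :=
          Finset.sum_mul _ _ _
      _ ≤ ∑ z ∈ T, cellConst n i n * N *
          ∫ y in Metric.ball (ε • latPt z) (ε / 2), (‖φ y‖ + 2 * cellRadius n * M * ε) :=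
          Finset.sum_le_sum fun z hz => hR.cell_integral_estimate hA hε hε1
            (lt_of_le_of_lt (by gcongr) hJ) ((hTz z hz).trans (by nlinarith)) hM0 hM
      _ = cellConst n i n * N * ∫ y in ⋃ z ∈ T, Metric.ball (ε • latPt z) (ε / 2),
          (‖φ y‖ + 2 * cellRadius n * M * ε) := by
          rw [← Finset.mul_sum, integral_biUnion_finset T (fun _ _ => measurableSet_ball)
            (pairwiseDisjoint_latBall hε (T : Set (Fin n → ℤ)))
            fun z hz => hint.mono_set (hsubB z hz)]
      _ ≤ cellConst n i n * N * ∫ y in B, (‖φ y‖ + 2 * cellRadius n * M * ε) := by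
          refine mul_le_mul_of_nonneg_left ?_ (by positivity)
          exact setIntegral_mono_set hint (Eventually.of_forall fun y => by positivity)
            (Set.iUnion₂_subset hsubB).eventuallyLE
      _ = _ := by
          rw [integral_add hφint.integrableOn (integrableOn_const measure_closedBall_lt_top.ne),
            setIntegral_const, smul_eq_mul, mul_comm (volume.real B)]
  have hlim1 : Tendsto (fun l => |cutoffSeq R A φ l| * cellVol n) atTop
      (𝓝 (|Λ φ| * cellVol n)) := (hΛ φ).abs.mul_const _
  have hlim2 : Tendsto (fun l : ℕ => cellConst n i n * N *
      ((∫ x in B, ‖φ x‖) + 2 * cellRadius n * M * 2⁻¹ ^ l * volume.real B)) atTop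
      (𝓝 (cellConst n i n * N * ((∫ x in B, ‖φ x‖)
        + 2 * cellRadius n * M * 0 * volume.real B))) := by
    refine Tendsto.const_mul _ (Tendsto.const_add _ (Tendsto.mul_const _ (Tendsto.const_mul _ ?_)))
    exact tendsto_pow_atTop_nhds_zero_of_lt_one (by norm_num) (by norm_num)
  have h := le_of_tendsto_of_tendsto hlim1 hlim2 (eventually_atTop.2 ⟨J, hest⟩)
  rw [mul_zero, zero_mul, add_zero, ← le_div_iff₀ hv] at h
  refine h.trans (le_of_eq ?_)
  ring

end IntegralBound

/-! ### Scalar densities, Lebesgue points and approximation by simple tensors. -/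

section Representation

variable {n : ℕ}

/-- On a ball of finite measure the integral norm is dominated by the `L²` norm. So `l` factors
through a subspace of `L²`, extends by Hahn–Banach, and is represented by Riesz; membership of the
density in `L¹` is all that is needed later. -/
theorem exists_integrable_density (l : TestFn n ℝ →ₗ[ℝ] ℝ) {ρ C : ℝ} (hC : 0 ≤ C)
    (h : ∀ ψ, |l ψ| ≤ C * ∫ x in Metric.closedBall 0 ρ, ‖ψ x‖) :
    ∃ f : Euc n → ℝ, Integrable f ∧ ∀ ψ, l ψ = ∫ x, f x * ψ x := by
  set B := Metric.closedBall (0 : Euc n) ρ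
  set μ := (volume : Measure (Euc n)).restrict B
  have : IsFiniteMeasure μ := ⟨by
    rw [Measure.restrict_apply_univ]
    exact measure_closedBall_lt_top⟩
  have hmem : ∀ ψ : TestFn n ℝ, MemLp ψ 2 μ := fun ψ =>
    ψ.continuous.memLp_of_hasCompactSupport ψ.hasCompactSupport
  let e : TestFn n ℝ →ₗ[ℝ] Lp ℝ 2 μ :=
    { toFun := fun ψ => (hmem ψ).toLp
      map_add' := fun _ _ => rfl
      map_smul' := fun _ _ => rfl }
  set K : ENNReal := μ Set.univ ^ (1 / (1 : ENNReal).toReal - 1 / (2 : ENNReal).toReal)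
  have hK : K ≠ ⊤ := ENNReal.rpow_ne_top_of_nonneg (by norm_num) (measure_ne_top μ _)
  have hbound : ∀ ψ, ‖l ψ‖ ≤ (C * K.toReal) * ‖e ψ‖ := by
    intro ψ
    have h1 : ∫ x, ‖ψ x‖ ∂μ ≤ ‖e ψ‖ * K.toReal := by
      rw [integral_norm_eq_lintegral_enorm (hmem ψ).1, ← eLpNorm_one_eq_lintegral_enorm]
      change _ ≤ ‖(hmem ψ).toLp‖ * _
      rw [Lp.norm_toLp, ← ENNReal.toReal_mul]
      exact ENNReal.toReal_mono (ENNReal.mul_ne_top (hmem ψ).eLpNorm_ne_top hK)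
        (eLpNorm_le_eLpNorm_mul_rpow_measure_univ one_le_two (hmem ψ).1)
    calc ‖l ψ‖ ≤ C * ∫ x, ‖ψ x‖ ∂μ := h ψ
      _ ≤ C * (‖e ψ‖ * K.toReal) := mul_le_mul_of_nonneg_left h1 hC
      _ = _ := by ring
  obtain ⟨g, hg, -⟩ := exists_extension_norm_eq (LinearMap.range e) (l.compLeftInverse e)
  set f₀ := (InnerProductSpace.toDual ℝ (Lp ℝ 2 μ)).symm g
  refine ⟨B.indicator f₀, ?_, fun ψ => ?_⟩
  · rw [integrable_indicator_iff measurableSet_closedBall]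
    exact (Lp.memLp f₀).integrable one_le_two
  · have h1 : l ψ = g (e ψ) := by
      rw [hg ⟨e ψ, LinearMap.mem_range_self e ψ⟩]
      exact (LinearMap.compLeftInverse_apply_of_bdd l e ⟨_, hbound⟩ ψ _ rfl).symm
    rw [h1, ← InnerProductSpace.toDual_symm_apply, L2.inner_def]
    have h2 : (fun x => B.indicator f₀ x * ψ x) = B.indicator fun x => f₀ x * ψ x := by
      ext x
      by_cases hx : x ∈ B <;> simp [hx]
    rw [h2, integral_indicator measurableSet_closedBall]
    refine integral_congr_ae ?_
    filter_upwards [(hmem ψ).coeFn_toLp] with x hx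
    have hx' : e ψ x = ψ x := hx
    rw [hx']
    simp [mul_comm, f₀]

/-- `a` is a Lebesgue point of `g`. -/
def IsLebesguePt {Z : Type*} [NormedAddCommGroup Z] (g : Euc n → Z) (a : Euc n) : Prop :=
  ∀ c : ℝ, 0 < c → Tendsto (fun r : ℝ =>
    (∫ x in Metric.closedBall a (c * r), ‖g x - g a‖) / r ^ n) (𝓝[>] 0) (𝓝 0)

theorem ae_isLebesguePt {Z : Type*} [NormedAddCommGroup Z] {g : Euc n → Z}
    (hg : LocallyIntegrable g) : ∀ᵐ a ∂volume, IsLebesguePt g a := by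
  filter_upwards [IsUnifLocDoublingMeasure.ae_tendsto_average_norm_sub volume hg 1] with a ha c hc
  have h := (ha (fun _ : ℝ => a) (fun r => c * r)
    (tendsto_const_mul_nhdsGT_zero hc) (by
    filter_upwards [self_mem_nhdsWithin] with r hr
    have hr : (0 : ℝ) < r := hr
    exact Metric.mem_closedBall_self (by positivity))).mul_const
      (c ^ n * volume.real (Metric.closedBall (0 : Euc n) 1))
  rw [zero_mul] at h
  refine h.congr' ?_
  filter_upwards [self_mem_nhdsWithin] with r hr
  have hr : (0 : ℝ) < r := hr
  have hpos : 0 < volume.real (Metric.closedBall (0 : Euc n) 1) :=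
    ENNReal.toReal_pos (Metric.measure_closedBall_pos volume _ one_pos).ne'
      measure_closedBall_lt_top.ne
  rw [setAverage_eq, volume_real_closedBall a (by positivity), smul_eq_mul, mul_pow]
  field_simp

variable {Y : Type*} [NormedAddCommGroup Y] [NormedSpace ℝ Y]

theorem integral_rescale {Z : Type*} [NormedAddCommGroup Z] [NormedSpace ℝ Z] (F : Euc n → Z)
    (a : Euc n) {r : ℝ} (hr : 0 < r) :
    ∫ x, F (r⁻¹ • (x - a)) = r ^ n • ∫ x, F x := by
  rw [integral_sub_right_eq_self (fun x => F (r⁻¹ • x)) a, Measure.integral_comp_smul,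
    finrank_euclideanSpace_fin, inv_pow, inv_inv, abs_of_pos (by positivity)]

theorem distrOf_apply_of_locallyIntegrable {F : Euc n → StrongDual ℝ Y} (hF : LocallyIntegrable F)
    (φ : TestFn n Y) : distrOf F φ = ∫ x, F x (φ x) := by
  rw [distrOf, TestFunction.integralAgainstBilinCLM_eq_integral (hF.locallyIntegrableOn _)]
  simp

theorem integrable_apply_testFn {F : Euc n → StrongDual ℝ Y} (hF : LocallyIntegrable F)
    (φ : TestFn n Y) : Integrable fun x => F x (φ x) := by
  simpa using TestFunction.integrable_bilin (ContinuousLinearMap.apply ℝ ℝ)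
    (hF.locallyIntegrableOn _) φ

theorem distrOf_const_apply (y : StrongDual ℝ Y) (φ : TestFn n Y) :
    distrOf (fun _ => y) φ = ∫ x, y (φ x) :=
  distrOf_apply_of_locallyIntegrable (locallyIntegrable_const y) φ

theorem distrOf_const_rescale (y : StrongDual ℝ Y) (φ : TestFn n Y) (a : Euc n) {r : ℝ}
    (hr : 0 < r) : distrOf (fun _ => y) (rescale a r φ) = r ^ n * ∫ x, y (φ x) := by
  rw [distrOf_const_apply, coe_rescale a hr.ne', integral_rescale (fun x => y (φ x)) a hr,
    smul_eq_mul]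

/-- At a Lebesgue point the rescaled distribution is close to that of the constant function. -/
theorem distrOf_sub_const_le {F : Euc n → StrongDual ℝ Y} (hF : LocallyIntegrable F) (a : Euc n)
    {r c M : ℝ} (hr : 0 < r) {φ : TestFn n Y}
    (hφ : tsupport φ ⊆ Metric.closedBall 0 c) (hφM : ∀ x, ‖φ x‖ ≤ M) :
    |distrOf F (rescale a r φ) - distrOf (fun _ => F a) (rescale a r φ)|
      ≤ M * ∫ x in Metric.closedBall a (c * r), ‖F x - F a‖ := by
  rw [distrOf_apply_of_locallyIntegrable hF, distrOf_const_apply,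
    ← integral_sub (integrable_apply_testFn hF _)
      (integrable_apply_testFn (locallyIntegrable_const (F a)) _), ← integral_const_mul]
  have hint : IntegrableOn (fun x => F x - F a) (Metric.closedBall a (c * r)) :=
    (hF.sub (locallyIntegrable_const (F a))).integrableOn_isCompact (isCompact_closedBall _ _)
  rw [← integral_indicator measurableSet_closedBall, ← Real.norm_eq_abs]
  refine (norm_integral_le_integral_norm _).trans (integral_mono_of_nonneg
    (Eventually.of_forall fun x => norm_nonneg _)
    ((integrable_indicator_iff measurableSet_closedBall).2 (hint.norm.const_mul M))
    (Eventually.of_forall fun x => ?_))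
  change ‖F x (rescale a r φ x) - F a (rescale a r φ x)‖ ≤ _
  by_cases hx : x ∈ Metric.closedBall a (c * r)
  · rw [Set.indicator_of_mem hx, ← sub_apply, rescale_apply a hr.ne', mul_comm]
    refine ((F x - F a).le_opNorm _).trans ?_
    gcongr
    exact hφM _
  · have h0 : rescale a r φ x = 0 := by
      by_contra h
      refine hx ?_
      rw [mul_comm]
      exact tsupport_rescale_subset a hr hφ (subset_tsupport _ h)
    rw [Set.indicator_of_notMem hx, h0]
    simp

/-- The test function `x ↦ ψ(x) y`. -/
def tensorTest (y : Y) : TestFn n ℝ →ₗ[ℝ] TestFn n Y :=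
  (TestFunction.postcompCLM (ContinuousLinearMap.toSpanSingleton ℝ y)).toLinearMap

theorem tensorTest_apply (y : Y) (ψ : TestFn n ℝ) (x : Euc n) : tensorTest y ψ x = ψ x • y := rfl

theorem rescale_tensorTest (y : Y) (ψ : TestFn n ℝ) (a : Euc n) {r : ℝ} (hr : r ≠ 0) :
    rescale a r (tensorTest y ψ) = tensorTest y (rescale a r ψ) := by
  ext x
  rw [rescale_apply a hr, tensorTest_apply, tensorTest_apply, rescale_apply a hr]

/-- The scalar test function `cellFn ε z`. -/
def cellTest {ε : ℝ} (hε : 0 < ε) (z : Fin n → ℤ) : TestFn n ℝ where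
  toFun := cellFn ε z
  contDiff' := contDiff_cellFn ε z
  hasCompactSupport' := hasCompactSupport_cellFn hε z
  tsupport_subset' := fun _ _ => trivial

theorem sum_cellFn_le_one {ε : ℝ} (hε : 0 < ε) (T : Finset (Fin n → ℤ)) (x : Euc n) :
    ∑ z ∈ T, cellFn ε z x ≤ 1 := by
  classical
  rw [← sum_cellFn_eq_one hε (x := x) (T ∪ cellsNear {x} ε (cellRadius n * ε)) fun z hz =>
    Finset.mem_union_right _ ((mem_cellsNear_singleton hε _ z).2 (by rwa [dist_comm]))]
  exact Finset.sum_le_sum_of_subset_of_nonneg Finset.subset_union_left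
    fun z _ _ => cellFn_nonneg ε z x

/-- Replace `φ` on each cell by a point of `D` within `t` of its value at the lattice point. With
Lipschitz constant `M` the error is at most `(1 + M * cellRadius n) * t`, on a fixed ball. -/
theorem exists_sum_tensorTest_near {D : Set Y} (hD : Dense D) (φ : TestFn n Y) {ε : ℝ}
    (hε : 0 < ε) : ∃ (T : Finset (Fin n → ℤ)) (ψ : (Fin n → ℤ) → TestFn n ℝ)
      (q : (Fin n → ℤ) → Y), (∀ z, q z ∈ D) ∧
        ∫ x, ‖φ x - ∑ z ∈ T, tensorTest (q z) (ψ z) x‖ ≤ ε := by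
  have hs := one_le_cellRadius n
  obtain ⟨ρ, hρ⟩ := φ.hasCompactSupport.isCompact.isBounded.subset_closedBall 0
  obtain ⟨M, hM0, hM⟩ := exists_scaledBoundOn_univ φ.contDiff φ.hasCompactSupport (0 + 1)
  set B := Metric.closedBall (0 : Euc n) (ρ + 2 * cellRadius n)
  set V := volume.real B
  have hV : 0 ≤ V := measureReal_nonneg
  obtain ⟨t, ht0, ht1, htε⟩ : ∃ t : ℝ, 0 < t ∧ t ≤ 1 ∧ (1 + M * cellRadius n) * t * V ≤ ε := by
    set K := (1 + M * cellRadius n) * V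
    have hK : 0 ≤ K := by positivity
    refine ⟨min 1 (ε / (K + 1)), by positivity, min_le_left _ _, ?_⟩
    calc (1 + M * cellRadius n) * min 1 (ε / (K + 1)) * V = K * min 1 (ε / (K + 1)) := by ring
      _ ≤ (K + 1) * (ε / (K + 1)) :=
        mul_le_mul (by linarith) (min_le_right _ _) (by positivity) (by positivity)
      _ = ε := by field_simp
  have hst : cellRadius n * t ≤ cellRadius n := by nlinarith
  have hq : ∀ z : Fin n → ℤ, ∃ q ∈ D, dist (φ (t • latPt z)) q < t := fun z =>
    hD.exists_dist_lt _ ht0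
  choose q hqD hq using hq
  set T := cellsNear {(0 : Euc n)} t (ρ + cellRadius n * t)
  refine ⟨T, cellTest ht0, q, hqD, ?_⟩
  have hpt : ∀ x, ‖φ x - ∑ z ∈ T, tensorTest (q z) (cellTest ht0 z) x‖
      ≤ B.indicator (fun _ => (1 + M * cellRadius n) * t) x := by
    intro x
    have h1 : φ x - ∑ z ∈ T, tensorTest (q z) (cellTest ht0 z) x
        = ∑ z ∈ T, cellFn t z x • (φ x - q z) := by
      simp only [smul_sub, Finset.sum_sub_distrib]
      congr 1
      rw [← Finset.sum_smul]
      by_cases hx : φ x = 0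
      · simp [hx]
      · rw [sum_cellFn_eq_one ht0 T fun z hz => (mem_cellsNear_singleton ht0 _ z).2 ?_, one_smul]
        have h1 : dist x 0 ≤ ρ := hρ (subset_tsupport _ hx)
        have := dist_triangle_left (t • latPt z) 0 x
        linarith
    have h2 : ∀ z, ‖cellFn t z x • (φ x - q z)‖
        ≤ cellFn t z x * ((1 + M * cellRadius n) * t) := by
      intro z
      rw [norm_smul, Real.norm_of_nonneg (cellFn_nonneg _ _ _)]
      by_cases h0 : cellFn t z x = 0
      · simp [h0]
      · refine mul_le_mul_of_nonneg_left ?_ (cellFn_nonneg _ _ _)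
        have h3 := norm_sub_le_of_scaledBoundOn hM x (t • latPt z)
        have h4 := dist_le_of_cellFn_ne_zero ht0 h0
        have h5 := norm_sub_le_norm_sub_add_norm_sub (φ x) (φ (t • latPt z)) (q z)
        have h6 := hq z
        rw [dist_eq_norm] at h4 h6
        have h7 := mul_le_mul_of_nonneg_left h4 hM0
        linarith
    rw [h1]
    by_cases hx : x ∈ B
    · rw [Set.indicator_of_mem hx]
      refine (norm_sum_le _ _).trans ((Finset.sum_le_sum fun z _ => h2 z).trans ?_)
      rw [← Finset.sum_mul]
      exact mul_le_of_le_one_left (by positivity) (sum_cellFn_le_one ht0 T x)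
    · rw [Set.indicator_of_notMem hx, norm_le_zero_iff]
      refine Finset.sum_eq_zero fun z hz => ?_
      have h0 : cellFn t z x = 0 := by
        by_contra h0
        apply hx
        have h3 := dist_le_of_cellFn_ne_zero ht0 h0
        have h4 := (mem_cellsNear_singleton ht0 _ z).1 hz
        have := dist_triangle x (t • latPt z) 0
        refine Metric.mem_closedBall.2 ?_
        linarith
      rw [h0, zero_smul]
  have hint : Integrable (B.indicator fun _ => (1 + M * cellRadius n) * t) :=
    (integrable_indicator_iff measurableSet_closedBall).2
      (integrableOn_const measure_closedBall_lt_top.ne)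
  refine (integral_mono_of_nonneg (Eventually.of_forall fun x => norm_nonneg _) hint
    (Eventually.of_forall hpt)).trans ?_
  rw [integral_indicator measurableSet_closedBall, setIntegral_const, smul_eq_mul, mul_comm]
  exact htε

/-- Sums of tensors with values in `D` are dense for the integral norm. Hence functionals bounded by
that norm need only be studied on such tensors. -/
theorem tensorTest_induction {D : Set Y} (hD : Dense D) {p : TestFn n Y → Prop} (h0 : p 0)
    (hadd : ∀ φ φ', p φ → p φ' → p (φ + φ')) (htensor : ∀ q ∈ D, ∀ ψ, p (tensorTest q ψ))
    (hclosed : ∀ φ, (∀ ε : ℝ, 0 < ε → ∃ φ', p φ' ∧ ∫ x, ‖(φ - φ') x‖ ≤ ε) → p φ)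
    (φ : TestFn n Y) : p φ := by
  classical
  refine hclosed φ fun ε hε => ?_
  obtain ⟨T, ψ, q, hq, hT⟩ := exists_sum_tensorTest_near hD φ hε
  refine ⟨∑ z ∈ T, tensorTest (q z) (ψ z), ?_, ?_⟩
  · exact Finset.sum_induction _ p hadd h0 fun z _ => htensor _ (hq z) _
  · simp only [← testFn_sum_apply] at hT
    exact hT

theorem exists_testFn_integral_eq_one (n : ℕ) : ∃ ψ : TestFn n ℝ, (∀ x, 0 ≤ ψ x) ∧
    ∫ x, ψ x = 1 := by
  let f : ContDiffBump (0 : Euc n) := ⟨1, 2, one_pos, one_lt_two⟩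
  exact ⟨⟨f.normed volume, f.contDiff_normed, f.hasCompactSupport_normed, fun _ _ => trivial⟩,
    fun x => f.nonneg_normed x, f.integral_normed⟩

theorem integral_norm_rescale (φ : TestFn n Y) (a : Euc n) {r : ℝ} (hr : 0 < r) :
    ∫ x, ‖rescale a r φ x‖ = r ^ n * ∫ x, ‖φ x‖ := by
  rw [coe_rescale a hr.ne', integral_rescale (fun x => ‖φ x‖) a hr, smul_eq_mul]

/-- If the rescaled values of a functional with an integral bound converge for simple tensors, then
they converge for all test functions, to the value of a constant density. -/
theorem exists_dual_tendsto {Λ : TestFn n Y →ₗ[ℝ] ℝ} {C : ℝ} (hC : 0 ≤ C)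
    (hΛ : ∀ φ, |Λ φ| ≤ C * ∫ x, ‖φ x‖) {D : Set Y} (hD : Dense D) {a : Euc n}
    (h : ∀ q ∈ D, ∃ c : ℝ, ∀ ψ : TestFn n ℝ,
      Tendsto (fun r : ℝ => Λ (rescale a r (tensorTest q ψ)) / r ^ n) (𝓝[>] 0)
        (𝓝 (c * ∫ x, ψ x))) :
    ∃ y : StrongDual ℝ Y, ‖y‖ ≤ C ∧ ∀ φ : TestFn n Y,
      Tendsto (fun r : ℝ => Λ (rescale a r φ) / r ^ n) (𝓝[>] 0) (𝓝 (∫ x, y (φ x))) := by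
  have hL : ∀ r : ℝ, 0 < r → ∀ φ, |Λ (rescale a r φ) / r ^ n| ≤ C * ∫ x, ‖φ x‖ := by
    intro r hr φ
    have h1 := hΛ (rescale a r φ)
    rw [integral_norm_rescale φ a hr] at h1
    rw [abs_div, abs_of_pos (pow_pos hr n), div_le_iff₀ (by positivity)]
    linarith
  have hadd : ∀ r φ φ', Λ (rescale a r (φ + φ')) / r ^ n
      = Λ (rescale a r φ) / r ^ n + Λ (rescale a r φ') / r ^ n := fun r φ φ' => by
    rw [rescale_add, map_add, add_div]
  have hsmul : ∀ r (c : ℝ) φ, Λ (rescale a r (c • φ)) / r ^ n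
      = c * (Λ (rescale a r φ) / r ^ n) := fun r c φ => by
    rw [rescale_smul, map_smul, smul_eq_mul, mul_div_assoc]
  have hconv : ∀ φ, ∃ v, Tendsto (fun r : ℝ => Λ (rescale a r φ) / r ^ n) (𝓝[>] 0) (𝓝 v) := by
    refine tensorTest_induction hD ⟨0, ?_⟩ ?_ ?_ ?_
    · refine tendsto_const_nhds.congr fun r => ?_
      have : rescale a r (0 : TestFn n Y) = 0 := (rescaleₗ a r).map_zero
      rw [this, map_zero, zero_div]
    · rintro φ φ' ⟨v, hv⟩ ⟨v', hv'⟩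
      exact ⟨v + v', (hv.add hv').congr fun r => (hadd r φ φ').symm⟩
    · intro q hq ψ
      obtain ⟨c, hc⟩ := h q hq
      exact ⟨_, hc ψ⟩
    · intro φ hφ
      -- The rescaled functionals are equibounded in the integral norm, so convergence on nearby
      -- `φ'` makes the values for `φ` Cauchy.
      refine cauchy_map_iff_exists_tendsto.1 (Metric.cauchy_iff.2 ⟨inferInstance, fun ε hε => ?_⟩)
      obtain ⟨φ', ⟨v, hv⟩, hφ'⟩ := hφ (ε / (4 * (C + 1))) (by positivity)
      have hev := hv (Metric.ball_mem_nhds v (show 0 < ε / 4 by positivity))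
      refine ⟨_, image_mem_map (inter_mem hev self_mem_nhdsWithin), ?_⟩
      have hclose : ∀ r : ℝ, 0 < r →
          |Λ (rescale a r φ) / r ^ n - Λ (rescale a r φ') / r ^ n| ≤ ε / 4 := by
        intro r hr
        have h1 := hL r hr (φ - φ')
        have h2 := hadd r (φ - φ') φ'
        rw [sub_add_cancel] at h2
        rw [h2, add_sub_cancel_right]
        refine h1.trans ?_
        calc C * ∫ x, ‖(φ - φ') x‖ ≤ (C + 1) * (ε / (4 * (C + 1))) :=
              mul_le_mul (by linarith) hφ' (integral_nonneg fun x => norm_nonneg _) (by positivity)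
          _ = ε / 4 := by field_simp
      rintro _ ⟨r, ⟨hr, hr0⟩, rfl⟩ _ ⟨s, ⟨hs, hs0⟩, rfl⟩
      have hr' : |Λ (rescale a r φ') / r ^ n - v| < ε / 4 := hr
      have hs' : |Λ (rescale a s φ') / s ^ n - v| < ε / 4 := hs
      have h1 := abs_le.1 (hclose r hr0)
      have h2 := abs_le.1 (hclose s hs0)
      rw [abs_lt] at hr' hs'
      rw [Real.dist_eq, abs_lt]
      constructor <;> linarith
  choose l hl using hconv
  have hladd : ∀ φ φ', l (φ + φ') = l φ + l φ' := fun φ φ' =>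
    tendsto_nhds_unique (hl _) (((hl φ).add (hl φ')).congr fun r => (hadd r φ φ').symm)
  have hlsmul : ∀ (c : ℝ) φ, l (c • φ) = c * l φ := fun c φ =>
    tendsto_nhds_unique (hl _) (((hl φ).const_mul c).congr fun r => (hsmul r c φ).symm)
  have hlbd : ∀ φ, |l φ| ≤ C * ∫ x, ‖φ x‖ := fun φ =>
    le_of_tendsto (hl φ).abs (by
      filter_upwards [self_mem_nhdsWithin] with r hr using hL r hr φ)
  obtain ⟨ψ₀, hψ₀, hψ₁⟩ := exists_testFn_integral_eq_one n
  -- Testing the limit functional with `ψ₀` of integral `1` must recover the sought element of the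
  -- dual.
  let y₀ : Y →ₗ[ℝ] ℝ :=
    { toFun := fun y => l (tensorTest y ψ₀)
      map_add' := fun y y' => by
        rw [← hladd]
        congr 1
        ext x
        exact smul_add _ _ _
      map_smul' := fun c y => by
        rw [RingHom.id_apply, smul_eq_mul, ← hlsmul]
        congr 1
        ext x
        exact smul_comm _ _ _ }
  have hy₀ : ∀ y, ‖y₀ y‖ ≤ C * ‖y‖ := fun y => by
    refine (hlbd (tensorTest y ψ₀)).trans (le_of_eq ?_)
    simp_rw [tensorTest_apply, norm_smul]
    rw [integral_mul_const]
    simp_rw [Real.norm_of_nonneg (hψ₀ _)]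
    rw [hψ₁, one_mul]
  refine ⟨y₀.mkContinuous C hy₀, y₀.mkContinuous_norm_le hC hy₀, fun φ => ?_⟩
  set y := y₀.mkContinuous C hy₀
  have hyn : ‖y‖ ≤ C := y₀.mkContinuous_norm_le hC hy₀
  suffices l φ = distrOf (fun _ => y) φ by
    rw [← distrOf_const_apply, ← this]
    exact hl φ
  have hSbd : ∀ φ : TestFn n Y, |distrOf (fun _ => y) φ| ≤ C * ∫ x, ‖φ x‖ := by
    intro φ
    rw [distrOf_const_apply, ← Real.norm_eq_abs, ← integral_const_mul]
    refine (norm_integral_le_integral_norm _).trans (integral_mono_of_nonneg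
      (Eventually.of_forall fun x => norm_nonneg _)
      ((testFn_integrable φ).norm.const_mul C) (Eventually.of_forall fun x => ?_))
    exact (y.le_opNorm _).trans (mul_le_mul_of_nonneg_right hyn (norm_nonneg _))
  refine tensorTest_induction (p := fun φ => l φ = distrOf (fun _ => y) φ) hD ?_ ?_ ?_ ?_ φ
  · have := hlsmul 0 0
    rw [zero_smul, zero_mul] at this
    rw [this, map_zero]
  · intro φ φ' h1 h2
    rw [hladd, map_add, h1, h2]
  · intro q hq ψ
    obtain ⟨c, hc⟩ := h q hq
    have h1 : ∀ ψ, l (tensorTest q ψ) = c * ∫ x, ψ x := fun ψ => tendsto_nhds_unique (hl _) (hc ψ)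
    have h2 : y q = c := by
      have := h1 ψ₀
      rw [hψ₁, mul_one] at this
      exact this
    rw [h1, distrOf_const_apply]
    simp_rw [tensorTest_apply, map_smul, h2, smul_eq_mul]
    rw [integral_mul_const, mul_comm]
  · intro φ hφ
    refine eq_of_abs_sub_le_all fun ε hε => ?_
    obtain ⟨φ', hφ', hlt⟩ := hφ (ε / (2 * (C + 1))) (by positivity)
    have h1 := hlbd (φ - φ')
    have h2 := hSbd (φ - φ')
    have h3 : l φ = l (φ - φ') + l φ' := by rw [← hladd, sub_add_cancel]
    have h4 : C * ∫ x, ‖(φ - φ') x‖ ≤ ε / 2 := by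
      calc C * ∫ x, ‖(φ - φ') x‖ ≤ (C + 1) * (ε / (2 * (C + 1))) :=
            mul_le_mul (by linarith) hlt (integral_nonneg fun x => norm_nonneg _) (by positivity)
        _ = ε / 2 := by field_simp
    rw [map_sub] at h2
    rw [h3, hφ']
    rw [abs_le] at *
    constructor <;> linarith [h1.1, h1.2, h2.1, h2.2]

end Representation

/-! ### Almost everywhere differentiation of the limit functional. -/

section Differentiation

variable {n : ℕ} {Y : Type*} [NormedAddCommGroup Y] [NormedSpace ℝ Y]

theorem IsLebesguePt.tendsto_distrOf {F : Euc n → StrongDual ℝ Y} (hF : LocallyIntegrable F)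
    {a : Euc n} (ha : IsLebesguePt F a) (φ : TestFn n Y) :
    Tendsto (fun r : ℝ => distrOf F (rescale a r φ) / r ^ n) (𝓝[>] 0) (𝓝 (∫ x, F a (φ x))) := by
  obtain ⟨ρ, hρ⟩ := φ.hasCompactSupport.isCompact.isBounded.subset_closedBall 0
  obtain ⟨M, hM⟩ := φ.hasCompactSupport.exists_bound_of_continuous φ.continuous
  set c := max ρ 1
  have hc : 0 < c := one_pos.trans_le (le_max_right _ _)
  have hφc : tsupport φ ⊆ Metric.closedBall 0 c :=
    hρ.trans (Metric.closedBall_subset_closedBall (le_max_left _ _))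
  rw [tendsto_iff_norm_sub_tendsto_zero]
  have hlim := (ha c hc).const_mul M
  rw [mul_zero] at hlim
  refine squeeze_zero' (Eventually.of_forall fun r => norm_nonneg _) ?_ hlim
  filter_upwards [self_mem_nhdsWithin] with r hr
  have hr : (0 : ℝ) < r := hr
  have hrn : 0 < r ^ n := pow_pos hr n
  have h1 := distrOf_sub_const_le hF a hr hφc hM
  rw [distrOf_const_rescale _ _ _ hr] at h1
  rw [Real.norm_eq_abs, ← mul_div_assoc, le_div_iff₀ hrn]
  refine le_trans (le_of_eq ?_) h1
  conv_lhs => rw [← abs_of_pos hrn, ← abs_mul]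
  congr 1
  rw [abs_of_pos hrn]
  field_simp

theorem exists_density_of_functional {Λ : TestFn n Y →ₗ[ℝ] ℝ} {ρ C : ℝ} (hC : 0 ≤ C)
    (hΛ : ∀ φ, |Λ φ| ≤ C * ∫ x in Metric.closedBall 0 ρ, ‖φ x‖) (y : Y) :
    ∃ f : Euc n → StrongDual ℝ ℝ, LocallyIntegrable f ∧
      ∀ ψ, Λ (tensorTest y ψ) = distrOf f ψ := by
  obtain ⟨f, hf, hfψ⟩ := exists_integrable_density (Λ ∘ₗ tensorTest y) (ρ := ρ)
    (C := C * ‖y‖) (by positivity) fun ψ => by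
      refine (hΛ (tensorTest y ψ)).trans (le_of_eq ?_)
      simp_rw [tensorTest_apply, norm_smul]
      rw [integral_mul_const]
      ring
  have hint := ((ContinuousLinearMap.mul ℝ ℝ).integrable_comp hf).locallyIntegrable
  refine ⟨_, hint, fun ψ => ?_⟩
  rw [distrOf_apply_of_locallyIntegrable hint]
  exact hfψ ψ

theorem norm_integral_bound {Λ : TestFn n Y →ₗ[ℝ] ℝ} {ρ C : ℝ} (hC : 0 ≤ C)
    (hΛ : ∀ φ, |Λ φ| ≤ C * ∫ x in Metric.closedBall 0 ρ, ‖φ x‖) (φ : TestFn n Y) :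
    |Λ φ| ≤ C * ∫ x, ‖φ x‖ :=
  (hΛ φ).trans (mul_le_mul_of_nonneg_left (setIntegral_le_integral (testFn_integrable φ).norm
    (Eventually.of_forall fun _ => norm_nonneg _)) hC)

/-- Countably many directions suffice by separability of `Y`, so the exceptional sets have null
union. The bound `‖y‖ ≤ C` is kept because it later makes the density locally integrable. -/
theorem ae_exists_dual_tendsto [SeparableSpace Y] {Λ : TestFn n Y →ₗ[ℝ] ℝ} {ρ C : ℝ} (hC : 0 ≤ C)
    (hΛ : ∀ φ, |Λ φ| ≤ C * ∫ x in Metric.closedBall 0 ρ, ‖φ x‖) :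
    ∀ᵐ a ∂volume, ∃ y : StrongDual ℝ Y, ‖y‖ ≤ C ∧ ∀ φ : TestFn n Y,
      Tendsto (fun r : ℝ => Λ (rescale a r φ) / r ^ n) (𝓝[>] 0) (𝓝 (∫ x, y (φ x))) := by
  choose f hf hfΛ using exists_density_of_functional hC hΛ
  have h : ∀ᵐ a ∂volume, ∀ m : ℕ, IsLebesguePt (f (denseSeq Y m)) a :=
    ae_all_iff.2 fun m => ae_isLebesguePt (hf _)
  filter_upwards [h] with a ha
  refine exists_dual_tendsto hC (norm_integral_bound hC hΛ) (denseRange_denseSeq Y) ?_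
  rintro _ ⟨m, rfl⟩
  refine ⟨f (denseSeq Y m) a 1, fun ψ => ?_⟩
  have h1 := (ha m).tendsto_distrOf (hf _) ψ
  have h2 : ∫ x, f (denseSeq Y m) a (ψ x) = f (denseSeq Y m) a 1 * ∫ x, ψ x := by
    rw [← integral_const_mul]
    refine integral_congr_ae (Eventually.of_forall fun x => ?_)
    change f (denseSeq Y m) a (ψ x) = f (denseSeq Y m) a 1 * ψ x
    rw [mul_comm, ← smul_eq_mul, ← map_smul, smul_eq_mul, mul_one]
  rw [h2] at h1
  refine h1.congr' ?_
  filter_upwards [self_mem_nhdsWithin] with r hr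
  rw [rescale_tensorTest _ _ _ (ne_of_gt hr), hfΛ]

/-- Evaluation on a dense sequence is a continuous injection of the Polish space `Y*` into `ℕ → ℝ`,
hence a measurable embedding, so weak measurability already gives measurability. -/
theorem aestronglyMeasurable_of_apply {α : Type*} [MeasurableSpace α] {μ : Measure α}
    [SeparableSpace Y] [SeparableSpace (StrongDual ℝ Y)] {F : α → StrongDual ℝ Y}
    (hF : ∀ y, AEMeasurable (fun x => F x y) μ) : AEStronglyMeasurable F μ := by
  let _ : MeasurableSpace (StrongDual ℝ Y) := borel _
  have : BorelSpace (StrongDual ℝ Y) := ⟨rfl⟩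
  have : SecondCountableTopology (StrongDual ℝ Y) := UniformSpace.secondCountable_of_separable _
  let e : StrongDual ℝ Y → ℕ → ℝ := fun y m => y (denseSeq Y m)
  have he : Continuous e := continuous_pi fun m =>
    (ContinuousLinearMap.apply ℝ ℝ (denseSeq Y m)).continuous
  have hinj : Function.Injective e := fun y y' h => by
    refine DFunLike.coe_injective ((denseRange_denseSeq Y).equalizer y.continuous y'.continuous ?_)
    exact h
  have hm := he.measurableEmbedding hinj
  refine AEMeasurable.aestronglyMeasurable (hm.aemeasurable_comp_iff.1 ?_)
  exact aemeasurable_pi_iff.2 fun m => hF _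

/-- The density is the pointwise limit from `ae_exists_dual_tendsto`. In each direction it agrees
almost everywhere with the scalar density, which yields measurability and, on tensors, the
representation. -/
theorem exists_dual_density [SeparableSpace Y] [SeparableSpace (StrongDual ℝ Y)]
    {Λ : TestFn n Y →ₗ[ℝ] ℝ} {ρ C : ℝ} (hC : 0 ≤ C)
    (hΛ : ∀ φ, |Λ φ| ≤ C * ∫ x in Metric.closedBall 0 ρ, ‖φ x‖) :
    ∃ F : Euc n → StrongDual ℝ Y, LocallyIntegrable F ∧ ∀ φ, Λ φ = distrOf F φ := by
  classical
  have hae := ae_exists_dual_tendsto hC hΛ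
  let p : Euc n → StrongDual ℝ Y → Prop := fun a y => ‖y‖ ≤ C ∧ ∀ φ : TestFn n Y,
      Tendsto (fun r : ℝ => Λ (rescale a r φ) / r ^ n) (𝓝[>] 0) (𝓝 (∫ x, y (φ x)))
  let F : Euc n → StrongDual ℝ Y := fun a => if h : ∃ y, p a y then h.choose else 0
  have hFp : ∀ᵐ a ∂volume, p a (F a) := by
    filter_upwards [hae] with a ha
    have ha' : ∃ y, p a y := ha
    simp only [F, dif_pos ha']
    exact ha'.choose_spec
  choose f hf hfΛ using exists_density_of_functional hC hΛ
  obtain ⟨ψ₀, -, hψ₁⟩ := exists_testFn_integral_eq_one n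
  have hFf : ∀ y, ∀ᵐ a ∂volume, F a y = f y a 1 := by
    intro y
    filter_upwards [hFp, ae_isLebesguePt (hf y)] with a ha hLa
    have h1 := ha.2 (tensorTest y ψ₀)
    have h2 := hLa.tendsto_distrOf (hf y) ψ₀
    have h3 := tendsto_nhds_unique (h1.congr' (by
      filter_upwards [self_mem_nhdsWithin] with r hr
      rw [rescale_tensorTest _ _ _ (ne_of_gt hr), hfΛ])) h2
    simp_rw [tensorTest_apply, map_smul, smul_eq_mul] at h3
    rw [integral_mul_const, hψ₁, one_mul] at h3
    rw [h3]
    calc ∫ x, f y a (ψ₀ x) = ∫ x, ψ₀ x * f y a 1 := by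
          refine integral_congr_ae (Eventually.of_forall fun x => ?_)
          change f y a (ψ₀ x) = ψ₀ x * f y a 1
          rw [← smul_eq_mul, ← map_smul, smul_eq_mul, mul_one]
      _ = f y a 1 := by rw [integral_mul_const, hψ₁, one_mul]
  have hFm : AEStronglyMeasurable F volume := aestronglyMeasurable_of_apply fun y =>
    (((ContinuousLinearMap.apply ℝ ℝ (1 : ℝ)).continuous.comp_aestronglyMeasurable
      (hf y).aestronglyMeasurable).congr ((hFf y).mono fun a ha => ha.symm)).aemeasurable
  have hFint : LocallyIntegrable F := (locallyIntegrable_const C).mono hFm (by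
    filter_upwards [hFp] with a ha
    exact ha.1.trans (le_abs_self C))
  refine ⟨F, hFint, fun φ => ?_⟩
  have hbd := norm_integral_bound hC hΛ
  have hSbd : ∀ φ : TestFn n Y, |distrOf F φ| ≤ C * ∫ x, ‖φ x‖ := by
    intro φ
    rw [distrOf_apply_of_locallyIntegrable hFint, ← Real.norm_eq_abs, ← integral_const_mul]
    refine (norm_integral_le_integral_norm _).trans (integral_mono_of_nonneg
      (Eventually.of_forall fun x => norm_nonneg _)
      ((testFn_integrable φ).norm.const_mul C) ?_)
    filter_upwards [hFp] with x hx
    exact ((F x).le_opNorm _).trans (mul_le_mul_of_nonneg_right hx.1 (norm_nonneg _))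
  refine tensorTest_induction (p := fun φ => Λ φ = distrOf F φ) dense_univ ?_ ?_ ?_ ?_ φ
  · rw [map_zero, map_zero]
  · intro φ φ' h1 h2
    rw [map_add, map_add, h1, h2]
  · intro y _ ψ
    rw [hfΛ, distrOf_apply_of_locallyIntegrable (hf y), distrOf_apply_of_locallyIntegrable hFint]
    refine integral_congr_ae ?_
    filter_upwards [hFf y] with x hx
    rw [tensorTest_apply, map_smul, hx, ← map_smul, smul_eq_mul, mul_one]
  · intro φ hφ
    refine eq_of_abs_sub_le_all fun ε hε => ?_
    obtain ⟨φ', hφ', hlt⟩ := hφ (ε / (2 * (C + 1))) (by positivity)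
    have h1 := hbd (φ - φ')
    have h2 := hSbd (φ - φ')
    have h4 : C * ∫ x, ‖(φ - φ') x‖ ≤ ε / 2 := by
      calc C * ∫ x, ‖(φ - φ') x‖ ≤ (C + 1) * (ε / (2 * (C + 1))) :=
            mul_le_mul (by linarith) hlt (integral_nonneg fun x => norm_nonneg _) (by positivity)
        _ = ε / 2 := by field_simp
    rw [map_sub] at h1 h2
    rw [hφ'] at h1
    rw [abs_le] at *
    constructor <;> linarith [h1.1, h1.2, h2.1, h2.2]

/-- A Lebesgue point of the `Y*`-valued density controls the deviation in the dual norm, hence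
simultaneously for all test functions bounded by `1`. -/
theorem ae_exists_dual_uniform [SeparableSpace Y] [SeparableSpace (StrongDual ℝ Y)]
    {Λ : TestFn n Y →ₗ[ℝ] ℝ} {ρ C : ℝ} (hC : 0 ≤ C)
    (hΛ : ∀ φ, |Λ φ| ≤ C * ∫ x in Metric.closedBall 0 ρ, ‖φ x‖) :
    ∀ᵐ a ∂volume, ∃ y : StrongDual ℝ Y, ∀ η : ℝ, 0 < η → ∀ᶠ r : ℝ in 𝓝[>] 0,
      ∀ φ : TestFn n Y, tsupport φ ⊆ Metric.closedBall 0 1 → (∀ x, ‖φ x‖ ≤ 1) →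
        |Λ (rescale a r φ) - distrOf (fun _ => y) (rescale a r φ)| ≤ η * r ^ n := by
  obtain ⟨F, hF, hΛF⟩ := exists_dual_density hC hΛ
  filter_upwards [ae_isLebesguePt hF] with a ha
  refine ⟨F a, fun η hη => ?_⟩
  filter_upwards [(ha 1 one_pos).eventually (ge_mem_nhds hη), self_mem_nhdsWithin]
    with r hr hr0 φ hφ hφ1
  have hr0 : (0 : ℝ) < r := hr0
  rw [div_le_iff₀ (by positivity)] at hr
  rw [hΛF]
  have := distrOf_sub_const_le hF a hr0 hφ hφ1
  linarith

end Differentiation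

/-! ### Taylor coefficients of jets and the passage between forms of smallness. -/

section Jets

variable {n : ℕ} {Y : Type*} [NormedAddCommGroup Y] [NormedSpace ℝ Y]

/-- Taylor expansion of a polynomial function. -/
theorem IsPolynomialOfDegreeLE.exists_taylor {W : Type*} [NormedAddCommGroup W] [NormedSpace ℝ W]
    [CompleteSpace W] {d : ℤ} {P : Euc n → W} (hP : IsPolynomialOfDegreeLE d P) (a : Euc n) :
    ∃ q : (m : ℕ) → ContinuousMultilinearMap ℝ (fun _ : Fin m => Euc n) W,
      (∀ N, (d + 1).toNat ≤ N → ∀ x, P (a + x) = ∑ m ∈ Finset.range N, q m fun _ => x) ∧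
      ∀ m x, m.factorial • q m (fun _ => x) = iteratedFDeriv ℝ m P a fun _ => x := by
  obtain ⟨c, hc⟩ := hP
  -- Truncating `c` gives a finite power series at `0`, which can be re-expanded at `a`.
  let p : FormalMultilinearSeries ℝ (Euc n) W := fun m => if m < (d + 1).toNat then c m else 0
  have hp : HasFiniteFPowerSeriesOnBall P p 0 (d + 1).toNat ⊤ := by
    refine HasFiniteFPowerSeriesOnBall.mk' (fun m hm => if_neg (not_lt.2 hm)) ENNReal.zero_lt_top
      fun y _ => ?_
    rw [zero_add, hc]
    refine Finset.sum_congr rfl fun m hm => ?_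
    simp only [p, if_pos (Finset.mem_range.1 hm)]
  have hp' := hp.changeOrigin (y := a) (by simp)
  rw [zero_add, ENNReal.top_sub_coe] at hp'
  refine ⟨p.changeOrigin a, fun N hN x => ?_, fun m x =>
    hp'.toHasFPowerSeriesOnBall.factorial_smul x m⟩
  exact hp'.eq_partialSum x (by simp) N hN

theorem distrOf_rescale_eq_sum {P : Euc n → StrongDual ℝ Y} (hP : Continuous P) {a : Euc n} {N : ℕ}
    {q : (m : ℕ) → ContinuousMultilinearMap ℝ (fun _ : Fin m => Euc n) (StrongDual ℝ Y)}
    (hq : ∀ x, P (a + x) = ∑ m ∈ Finset.range N, q m fun _ => x) {r : ℝ} (hr : 0 < r)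
    (φ : TestFn n Y) : distrOf P (rescale a r φ)
      = r ^ n * ∑ m ∈ Finset.range N, r ^ m * ∫ x, q m (fun _ => x) (φ x) := by
  rw [distrOf_apply_of_locallyIntegrable hP.locallyIntegrable]
  have h1 : (fun x => P x (rescale a r φ x))
      = fun x => (fun z => P (a + r • z) (φ z)) (r⁻¹ • (x - a)) := by
    ext x
    simp only
    rw [rescale_apply a hr.ne', smul_inv_smul₀ hr.ne', add_sub_cancel]
  have hcont : ∀ m, Continuous fun x : Euc n => q m fun _ => x := fun m =>
    (q m).cont.comp (continuous_pi fun _ => continuous_id)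
  rw [h1, integral_rescale (fun z => P (a + r • z) (φ z)) a hr, smul_eq_mul]
  congr 1
  calc ∫ z, P (a + r • z) (φ z)
      = ∫ z, ∑ m ∈ Finset.range N, r ^ m * q m (fun _ => z) (φ z) := by
        refine integral_congr_ae (Eventually.of_forall fun z => ?_)
        simp only
        rw [hq, sum_apply]
        refine Finset.sum_congr rfl fun m _ => ?_
        rw [(q m).map_smul_univ (fun _ => r) fun _ => z]
        simp
    _ = ∑ m ∈ Finset.range N, r ^ m * ∫ x, q m (fun _ => x) (φ x) := by
        rw [integral_finsetSum _ fun m _ =>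
          (integrable_apply_testFn (hcont m).locallyIntegrable φ).const_mul _]
        simp_rw [integral_const_mul]

/-- By strong induction the lower coefficients vanish, so dividing the sum by `r ^ j` leaves `b j`
in the limit, while the hypothesis makes the same limit `0`. -/
theorem coeff_eq_zero_of_tendsto {N m : ℕ} {b : ℕ → ℝ}
    (h : Tendsto (fun r : ℝ => (∑ j ∈ Finset.range N, r ^ j * b j) / r ^ m) (𝓝[>] 0) (𝓝 0)) :
    ∀ j ≤ m, j < N → b j = 0 := by
  intro j
  induction j using Nat.strong_induction_on with
  | _ j ih =>
    intro hjm hjN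
    have h1 : Tendsto (fun r : ℝ => ∑ l ∈ Finset.range (N - j), r ^ l * b (j + l)) (𝓝[>] 0)
        (𝓝 (∑ l ∈ Finset.range (N - j), (0 : ℝ) ^ l * b (j + l))) := by
      refine Tendsto.mono_left ?_ nhdsWithin_le_nhds
      exact (continuous_finsetSum _ fun l _ =>
        (continuous_pow l).mul continuous_const).tendsto 0
    have h0 : ∑ l ∈ Finset.range (N - j), (0 : ℝ) ^ l * b (j + l) = b j := by
      rw [Finset.sum_eq_single 0]
      · simp
      · intro l _ hl
        simp [hl]
      · intro hl
        exact absurd (Finset.mem_range.2 (by omega)) hl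
    rw [h0] at h1
    have h2 : Tendsto (fun r : ℝ => r ^ (m - j) *
        ((∑ j ∈ Finset.range N, r ^ j * b j) / r ^ m)) (𝓝[>] 0) (𝓝 (0 ^ (m - j) * 0)) :=
      Tendsto.mul (((continuous_pow (m - j)).tendsto 0).mono_left nhdsWithin_le_nhds) h
    rw [mul_zero] at h2
    refine tendsto_nhds_unique (h1.congr' ?_) h2
    filter_upwards [self_mem_nhdsWithin] with r hr
    have hr : (0 : ℝ) < r := hr
    have hsplit : ∑ l ∈ Finset.range N, r ^ l * b l
        = r ^ j * ∑ l ∈ Finset.range (N - j), r ^ l * b (j + l) := by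
      rw [← Nat.add_sub_of_le hjN.le, Finset.sum_range_add, Nat.add_sub_of_le hjN.le,
        Finset.sum_eq_zero, zero_add, Finset.mul_sum]
      · refine Finset.sum_congr rfl fun l _ => ?_
        rw [pow_add, mul_assoc]
      · intro l hl
        have := Finset.mem_range.1 hl
        rw [ih l this (by omega) (by omega), mul_zero]
    rw [hsplit, mul_div_assoc', ← mul_assoc, ← pow_add, Nat.sub_add_cancel hjm]
    field_simp

theorem eq_zero_of_integral_testFn_eq_zero {g : Euc n → StrongDual ℝ Y} (hg : Continuous g)
    (h : ∀ φ : TestFn n Y, ∫ x, g x (φ x) = 0) (x : Euc n) : g x = 0 := by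
  refine ContinuousLinearMap.ext fun y => ?_
  have hgy : Continuous fun x => g x y := (ContinuousLinearMap.apply ℝ ℝ y).continuous.comp hg
  have hae : ∀ᵐ x ∂(volume : Measure (Euc n)), g x y = 0 := by
    refine ae_eq_zero_of_integral_contDiff_smul_eq_zero hgy.locallyIntegrable
      fun ψ hψ hc => ?_
    have := h (tensorTest y ⟨ψ, hψ, hc, fun _ _ => trivial⟩)
    refine Eq.trans (integral_congr_ae (Eventually.of_forall fun x => ?_)) this
    rw [tensorTest_apply, map_smul]
    rfl
  exact congrFun ((hgy.ae_eq_iff_eq volume continuous_const).1 hae) x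

theorem zpow_neg_sub_eq (k : ℕ) (r : ℝ) :
    r ^ (-(k : ℤ) - (n : ℤ)) = (r ^ (n + k))⁻¹ := by
  rw [← zpow_natCast, ← zpow_neg]
  congr 1
  push_cast
  ring

/-- Smallness on `unitTestFns`, uniformly, implies smallness for each test function. -/
theorem tendsto_of_forall_eventually_le {T : TestFn n Y →ₗ[ℝ] ℝ} {i p : ℕ} {a : Euc n}
    (h : ∀ η : ℝ, 0 < η → ∀ᶠ r : ℝ in 𝓝[>] 0,
      ∀ φ ∈ unitTestFns (nu i (Metric.closedBall 0 1)), |T (rescale a r φ)| ≤ η * r ^ p)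
    (φ : TestFn n Y) : Tendsto (fun r : ℝ => T (rescale a r φ) / r ^ p) (𝓝[>] 0) (𝓝 0) := by
  obtain ⟨c, t, hc, ht, ψ, hψ, hφ⟩ := exists_rescale_eq i φ
  rw [Metric.tendsto_nhds]
  intro ε hε
  filter_upwards [(tendsto_const_mul_nhdsGT_zero ht).eventually
    (h (ε / (2 * c * t ^ p)) (by positivity)), self_mem_nhdsWithin] with r hr hr0
  have hr0 : (0 : ℝ) < r := hr0
  have h1 := hr ψ hψ
  rw [dist_zero_right, Real.norm_eq_abs, abs_div, abs_of_pos (pow_pos hr0 p),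
    div_lt_iff₀ (by positivity), hφ a r hr0.ne', map_smul, smul_eq_mul, abs_mul, abs_of_pos hc]
  calc c * |T (rescale a (t * r) ψ)| ≤ c * (ε / (2 * c * t ^ p) * (t * r) ^ p) :=
        mul_le_mul_of_nonneg_left h1 hc.le
    _ = ε / 2 * r ^ p := by
        rw [mul_pow]
        field_simp
    _ < ε * r ^ p := by
        have : 0 < r ^ p := by positivity
        nlinarith

theorem forall_eventually_le_of_lt {T : TestFn n Y →ₗ[ℝ] ℝ} {i p p' : ℕ} {a : Euc n} {N : ℝ}
    (hN : 0 ≤ N) (hpp : p' < p) (h : ∀ᶠ r : ℝ in 𝓝[>] 0,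
      ∀ φ ∈ unitTestFns (nu i (Metric.closedBall 0 1)), |T (rescale a r φ)| ≤ N * r ^ p)
    {η : ℝ} (hη : 0 < η) : ∀ᶠ r : ℝ in 𝓝[>] 0,
      ∀ φ ∈ unitTestFns (nu i (Metric.closedBall 0 1)), |T (rescale a r φ)| ≤ η * r ^ p' := by
  filter_upwards [h, self_mem_nhdsWithin,
    Ioo_mem_nhdsGT (show 0 < min 1 (η / (N + 1)) by positivity)] with r hr hr0 hr1 φ hφ
  have hr0 : (0 : ℝ) < r := hr0
  refine (hr φ hφ).trans ?_
  obtain ⟨d, rfl⟩ := Nat.exists_eq_add_of_lt hpp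
  have h1 : r ^ (d + 1) ≤ r :=
    pow_le_of_le_one hr0.le (hr1.2.le.trans (min_le_left _ _)) (Nat.succ_ne_zero d)
  have h2 : N * r ≤ η := by
    have h3 := hr1.2.trans_le (min_le_right _ _)
    rw [lt_div_iff₀ (by positivity)] at h3
    nlinarith
  calc N * r ^ (p' + d + 1) = N * r ^ (d + 1) * r ^ p' := by
        rw [add_assoc, pow_add]
        ring
    _ ≤ N * r * r ^ p' := by gcongr
    _ ≤ η * r ^ p' := by gcongr

/-- The supremum is never negative because the zero function is admissible, so only the upper bound
matters. -/
theorem tendsto_iSup_of_forall_eventually_le {T : TestFn n Y →ₗ[ℝ] ℝ} {i k : ℕ} {a : Euc n}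
    (h : ∀ η : ℝ, 0 < η → ∀ᶠ r : ℝ in 𝓝[>] 0,
      ∀ φ ∈ unitTestFns (nu i (Metric.closedBall 0 1)), |T (rescale a r φ)| ≤ η * r ^ (n + k)) :
    Tendsto (fun r : ℝ => ⨆ φ ∈ unitTestFns (Y := Y) (nu i (Metric.closedBall (0 : Euc n) 1)),
        ((r ^ (-(k : ℤ) - (n : ℤ)) * T (rescale a r φ) : ℝ) : EReal)) (𝓝[>] 0) (𝓝 0) := by
  refine tendsto_order.2 ⟨fun b hb => Eventually.of_forall fun r => hb.trans_le ?_, fun b hb => ?_⟩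
  · refine le_iSup₂_of_le 0 (zero_mem_unitTestFns i) ?_
    have : rescale a r (0 : TestFn n Y) = 0 := (rescaleₗ a r).map_zero
    simp [this]
  · obtain ⟨η, hη0, hηb⟩ := EReal.lt_iff_exists_real_btwn.1 hb
    have hη : 0 < η := by exact_mod_cast hη0
    filter_upwards [h η hη, self_mem_nhdsWithin] with r hr hr0
    have hr0 : (0 : ℝ) < r := hr0
    refine lt_of_le_of_lt (iSup₂_le fun φ hφ => ?_) hηb
    rw [EReal.coe_le_coe_iff, zpow_neg_sub_eq, inv_mul_le_iff₀ (by positivity), mul_comm]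
    exact (le_abs_self _).trans (hr φ hφ)

theorem isPolynomialOfDegreeLE_const {W : Type*} [NormedAddCommGroup W] [NormedSpace ℝ W] (k : ℕ)
    (w : W) : IsPolynomialOfDegreeLE (n := n) (k : ℤ) fun _ => w := by
  refine ⟨fun m => match m with
    | 0 => ContinuousMultilinearMap.constOfIsEmpty ℝ _ w
    | _ + 1 => 0, fun x => ?_⟩
  have : ((k : ℤ) + 1).toNat = k + 1 := by omega
  rw [this, Finset.sum_range_succ']
  simp

theorem isJet_const_of_tendsto {R : Distr n Y} {k : ℕ} {a : Euc n} {y : StrongDual ℝ Y}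
    (h : ∀ φ, Tendsto (fun r : ℝ => (R - distrOf (fun _ => y) : Distr n Y) (rescale a r φ) / r ^ (n + k))
      (𝓝[>] 0) (𝓝 0)) : IsJet R k a fun _ => y := by
  refine ⟨isPolynomialOfDegreeLE_const k y, fun φ => (h φ).congr fun r => ?_⟩
  rw [zpow_neg_sub_eq, div_eq_inv_mul]

/-- The one-sided supremum bounds absolute values because the admissible test functions are
symmetric under negation. -/
theorem exists_bound_of_limsup_lt_top {T : TestFn n Y →ₗ[ℝ] ℝ} {i k : ℕ} {a : Euc n}
    (h : limsup (fun r : ℝ => ⨆ φ ∈ unitTestFns (Y := Y) (nu i (Metric.closedBall (0 : Euc n) 1)),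
        ((r ^ (-(((k : ℤ) - 1 : ℤ) : ℝ) - 1 - (n : ℝ)) * T (rescale a r φ) : ℝ) : EReal))
      (𝓝[>] 0) < ⊤) :
    ∃ N : ℝ, 0 ≤ N ∧ ∀ᶠ r : ℝ in 𝓝[>] 0,
      ∀ φ ∈ unitTestFns (nu i (Metric.closedBall 0 1)), |T (rescale a r φ)| ≤ N * r ^ (n + k) := by
  obtain ⟨N, hN, -⟩ := EReal.lt_iff_exists_real_btwn.1 h
  refine ⟨max N 0, le_max_right _ _, ?_⟩
  filter_upwards [eventually_lt_of_limsup_lt hN, self_mem_nhdsWithin] with r hr hr0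
  have hr0 : (0 : ℝ) < r := hr0
  have hpow : r ^ (-(((k : ℤ) - 1 : ℤ) : ℝ) - 1 - (n : ℝ)) = (r ^ (n + k))⁻¹ := by
    rw [← Real.rpow_natCast, ← Real.rpow_neg hr0.le]
    congr 1
    push_cast
    ring
  have key : ∀ φ ∈ unitTestFns (Y := Y) (nu i (Metric.closedBall (0 : Euc n) 1)),
      T (rescale a r φ) ≤ max N 0 * r ^ (n + k) := by
    intro φ hφ
    have h1 := (le_iSup₂ (f := fun (φ : TestFn n Y)
      (_ : φ ∈ unitTestFns (nu i (Metric.closedBall (0 : Euc n) 1))) =>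
        ((r ^ (-(((k : ℤ) - 1 : ℤ) : ℝ) - 1 - (n : ℝ)) * T (rescale a r φ) : ℝ) : EReal))
        φ hφ).trans hr.le
    rw [EReal.coe_le_coe_iff, hpow, inv_mul_le_iff₀ (by positivity)] at h1
    refine h1.trans ?_
    rw [mul_comm]
    gcongr
    exact le_max_left _ _
  intro φ hφ
  refine abs_le.2 ⟨?_, key φ hφ⟩
  have h2 := key (-φ) (neg_mem_unitTestFns hφ)
  have h3 : rescale a r (-φ) = -rescale a r φ := (rescaleₗ a r).map_neg φ
  rw [h3, map_neg] at h2
  linarith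

/-- If all pointwise differentials of order less than `k` vanish, then the polynomial in the
definition of pointwise differentiability of order `(k - 1, 1)` vanishes. -/
theorem eq_zero_of_hasPointwiseDifferential_zero {R : Distr n Y} {i k : ℕ} {a : Euc n}
    {P : Euc n → StrongDual ℝ Y} (hP : IsPolynomialOfDegreeLE ((k : ℤ) - 1) P) {N : ℝ} (hN : 0 ≤ N)
    (hR : ∀ᶠ r : ℝ in 𝓝[>] 0, ∀ φ ∈ unitTestFns (nu i (Metric.closedBall 0 1)),
      |(R - distrOf P) (rescale a r φ)| ≤ N * r ^ (n + k))
    (h0 : ∀ m < k, HasPointwiseDifferential R m a 0) (x : Euc n) : P x = 0 := by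
  obtain ⟨q, hq, -⟩ := hP.exists_taylor a
  have hcont : ∀ {m : ℕ} (q : ContinuousMultilinearMap ℝ (fun _ : Fin m => Euc n) (StrongDual ℝ Y)),
      Continuous fun x : Euc n => q fun _ => x := fun q =>
    q.cont.comp (continuous_pi fun _ => continuous_id)
  have hqk := hq k (by omega)
  suffices hz : ∀ m < k, ∀ x, (q m fun _ => x) = 0 by
    have := hqk (x - a)
    rw [add_sub_cancel] at this
    rw [this]
    exact Finset.sum_eq_zero fun m hm => hz m (Finset.mem_range.1 hm) _
  intro m hm
  refine eq_zero_of_integral_testFn_eq_zero (hcont (q m)) fun φ => ?_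
  -- The hypothesis of order `m` only makes the top coefficient of its own jet vanish, so each `m`
  -- is treated with its own `Q`; no uniqueness of jets is required.
  obtain ⟨Q, ⟨hQ, hjet⟩, hQ0⟩ := h0 m hm
  obtain ⟨s, hs, hsm⟩ := hQ.exists_taylor a
  have hsk := hs (m + 1) (by omega)
  have hs0 : ∀ x, (s m fun _ => x) = 0 := fun x => by
    have := hsm m x
    rw [hQ0, ← Nat.cast_smul_eq_nsmul ℝ] at this
    exact (smul_eq_zero.1 this).resolve_left (Nat.cast_ne_zero.2 (Nat.factorial_ne_zero m))
  have h1 := tendsto_of_forall_eventually_le (T := (R - distrOf P : Distr n Y).toLinearMap)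
    (fun η hη => forall_eventually_le_of_lt (p' := n + m) hN (by omega) hR hη) φ
  have h2 := (hjet φ).sub h1
  rw [sub_zero] at h2
  -- The coefficients of the rescaled difference of `P` and `Q`, both of which approximate `R` to
  -- order `o(r ^ (n + m))`.
  let b : ℕ → ℝ := fun j => (∫ x, q j (fun _ => x) (φ x))
    - if j < m + 1 then ∫ x, s j (fun _ => x) (φ x) else 0
  have h3 : Tendsto (fun r : ℝ => (∑ j ∈ Finset.range k, r ^ j * b j) / r ^ m)
      (𝓝[>] 0) (𝓝 0) := by
    refine h2.congr' ?_
    filter_upwards [self_mem_nhdsWithin] with r hr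
    have hr : (0 : ℝ) < r := hr
    have e1 := distrOf_rescale_eq_sum hP.continuous hqk hr φ
    have e2 := distrOf_rescale_eq_sum hQ.continuous hsk hr φ
    have e3 : ∑ j ∈ Finset.range k, r ^ j * (if j < m + 1 then ∫ x, s j (fun _ => x) (φ x) else 0)
        = ∑ j ∈ Finset.range (m + 1), r ^ j * ∫ x, s j (fun _ => x) (φ x) := by
      rw [← Finset.sum_subset (Finset.range_subset_range.2 (show m + 1 ≤ k by omega))]
      · exact Finset.sum_congr rfl fun j hj => by rw [if_pos (Finset.mem_range.1 hj)]
      · intro j _ hj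
        rw [if_neg (by simpa using hj), mul_zero]
    rw [zpow_neg_sub_eq]
    change (r ^ (n + m))⁻¹ * (R (rescale a r φ) - distrOf Q (rescale a r φ))
      - (R (rescale a r φ) - distrOf P (rescale a r φ)) / r ^ (n + m) = _
    simp only [b, mul_sub, Finset.sum_sub_distrib]
    rw [e3, e1, e2, pow_add]
    field_simp
    ring
  have h4 := coeff_eq_zero_of_tendsto h3 m le_rfl hm
  simp only [b, if_pos (Nat.lt_succ_self m), hs0] at h4
  simpa using h4

end Jets

/-! ### Countable decomposition and the two cases. -/

section Main

variable {n : ℕ} {Y : Type*} [NormedAddCommGroup Y] [NormedSpace ℝ Y]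

/-- The points of the ball of radius `N` where `R` is of order `r ^ (n + k)`, quantified by `N`. -/
def boundedOrderSet (R : Distr n Y) (i k N : ℕ) : Set (Euc n) :=
  {a | ‖a‖ ≤ N ∧ ∀ r : ℝ, 0 < r → r < 1 / ((N : ℝ) + 1) →
    ∀ φ ∈ unitTestFns (nu i (Metric.closedBall 0 1)), |R (rescale a r φ)| ≤ N * r ^ (n + k)}

theorem isBounded_boundedOrderSet (R : Distr n Y) (i k N : ℕ) :
    Bornology.IsBounded (boundedOrderSet R i k N) :=
  Metric.isBounded_closedBall.subset fun _ ha => mem_closedBall_zero_iff.2 ha.1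

theorem locBound_boundedOrderSet (R : Distr n Y) (i k N : ℕ) :
    LocBound R.toLinearMap i (n + k) (boundedOrderSet R i k N) N (1 / ((N : ℝ) + 1)) :=
  locBound_of_unitTestFns fun _ ha r hr hrδ φ hφ => ha.2 r hr hrδ φ hφ

/-- A single integer dominates the norm of `a`, the constant and the inverse of the admissible
radius, which makes the decomposition countable. -/
theorem exists_mem_boundedOrderSet {R : Distr n Y} {i k : ℕ} {a : Euc n} {C : ℝ}
    (h : ∀ᶠ r : ℝ in 𝓝[>] 0, ∀ φ ∈ unitTestFns (nu i (Metric.closedBall 0 1)),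
      |R (rescale a r φ)| ≤ C * r ^ (n + k)) : ∃ N, a ∈ boundedOrderSet R i k N := by
  obtain ⟨δ, hδ, hδr⟩ := mem_nhdsGT_iff_exists_Ioo_subset.1 h
  have hδ : (0 : ℝ) < δ := hδ
  obtain ⟨N, hN⟩ := exists_nat_ge (max (max ‖a‖ C) δ⁻¹)
  refine ⟨N, ((le_max_left _ _).trans (le_max_left _ _)).trans hN, fun r hr hrN φ hφ => ?_⟩
  have h1 : δ⁻¹ ≤ N := (le_max_right _ _).trans hN
  have h2 : C ≤ N := ((le_max_right _ _).trans (le_max_left _ _)).trans hN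
  have h3 : 1 / ((N : ℝ) + 1) ≤ δ := by
    rw [one_div]
    exact inv_le_of_inv_le₀ hδ (by linarith)
  exact (hδr ⟨hr, hrN.trans_le h3⟩ φ hφ).trans (by gcongr)

theorem distrOf_const_zero : distrOf (n := n) (fun _ => (0 : StrongDual ℝ Y)) = 0 := by
  ext φ
  rw [distrOf_const_apply]
  simp

theorem ae_forall_eventually_le_of_pos (R : Distr n Y) {i k : ℕ} (hk : 0 < k) (N : ℕ) :
    ∀ᵐ a ∂volume, a ∈ boundedOrderSet R i k N → ∀ η : ℝ, 0 < η → ∀ᶠ r : ℝ in 𝓝[>] 0,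
      ∀ φ ∈ unitTestFns (nu i (Metric.closedBall 0 1)),
        |(R - distrOf (fun _ => 0) : Distr n Y) (rescale a r φ)| ≤ η * r ^ (n + k) := by
  filter_upwards [ae_isDensityPt (boundedOrderSet R i k N)] with a ha haN η hη
  rw [distrOf_const_zero, sub_zero]
  exact (locBound_boundedOrderSet R i k N).eventually_le (by positivity) (by positivity) hk haN
    (ha haN) hη

/-- The difference `R - Λ` is uniformly negligible at density points, so `R` inherits the constant
jet of `Λ`: for each test function in general, uniformly when `Y*` is separable. -/
theorem ae_exists_isJet_zero [SeparableSpace Y] (R : Distr n Y) (i N : ℕ) :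
    ∀ᵐ a ∂volume, a ∈ boundedOrderSet R i 0 N →
      (∃ y : StrongDual ℝ Y, ∀ φ, Tendsto (fun r : ℝ =>
        (R - distrOf (fun _ => y) : Distr n Y) (rescale a r φ) / r ^ (n + 0)) (𝓝[>] 0) (𝓝 0)) ∧
      (SeparableSpace (StrongDual ℝ Y) → ∃ y : StrongDual ℝ Y, ∀ η : ℝ, 0 < η →
        ∀ᶠ r : ℝ in 𝓝[>] 0, ∀ φ ∈ unitTestFns (nu i (Metric.closedBall 0 1)),
          |(R - distrOf (fun _ => y) : Distr n Y) (rescale a r φ)| ≤ η * r ^ (n + 0)) := by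
  set A := boundedOrderSet R i 0 N
  rcases A.eq_empty_or_nonempty with hA | hA
  · simp [hA]
  have hb : Bornology.IsBounded A := isBounded_boundedOrderSet R i 0 N
  have hR : LocBound R.toLinearMap i n A N (1 / ((N : ℝ) + 1)) := locBound_boundedOrderSet R i 0 N
  have hN : (0 : ℝ) ≤ N := by positivity
  have hδ : 0 < 1 / ((N : ℝ) + 1) := by positivity
  obtain ⟨Λ, hΛ⟩ := hR.exists_limit hb hA hN hδ
  obtain ⟨ρ, C, hC, hΛC⟩ := hR.limit_le hb hA hN hδ hΛ
  have hdens : ∀ᵐ a ∂volume, SeparableSpace (StrongDual ℝ Y) →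
      ∃ y : StrongDual ℝ Y, ∀ η : ℝ, 0 < η → ∀ᶠ r : ℝ in 𝓝[>] 0,
      ∀ φ : TestFn n Y, tsupport φ ⊆ Metric.closedBall 0 1 → (∀ x, ‖φ x‖ ≤ 1) →
        |Λ (rescale a r φ) - distrOf (fun _ => y) (rescale a r φ)| ≤ η * r ^ n := by
    by_cases hsep : SeparableSpace (StrongDual ℝ Y)
    · exact (ae_exists_dual_uniform hC hΛC).mono fun a ha _ => ha
    · exact Eventually.of_forall fun a h => absurd h hsep
  filter_upwards [ae_isDensityPt A, ae_exists_dual_tendsto hC hΛC, hdens] with a ha hlim hunif haA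
  have hsub : ∀ η : ℝ, 0 < η → ∀ᶠ r : ℝ in 𝓝[>] 0,
      ∀ φ ∈ unitTestFns (nu i (Metric.closedBall 0 1)),
        |(R.toLinearMap - Λ) (rescale a r φ)| ≤ η * r ^ n := fun η hη =>
    hR.eventually_sub_le hb hN hδ hΛ haA (ha haA) hη
  refine ⟨?_, fun hsep => ?_⟩
  · obtain ⟨y, -, hy⟩ := hlim
    refine ⟨y, fun φ => ?_⟩
    have h1 := (tendsto_of_forall_eventually_le hsub φ).add ((hy φ).sub_const (∫ x, y (φ x)))
    rw [sub_self, add_zero] at h1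
    refine h1.congr' ?_
    filter_upwards [self_mem_nhdsWithin] with r hr
    have hr : (0 : ℝ) < r := hr
    change (R (rescale a r φ) - Λ (rescale a r φ)) / r ^ n + _
      = (R (rescale a r φ) - distrOf (fun _ => y) (rescale a r φ)) / r ^ (n + 0)
    rw [distrOf_const_rescale _ _ _ hr, add_zero]
    field_simp
    ring
  · obtain ⟨y, hy⟩ := hunif hsep
    refine ⟨y, fun η hη => ?_⟩
    filter_upwards [hsub (η / 2) (half_pos hη), hy (η / 2) (half_pos hη)] with r h1 h2 φ hφ
    have h3 := h1 φ hφ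
    have h4 := h2 φ hφ.1 fun x =>
      (scaledBoundOn_of_mem_unitTestFns hφ).norm_le (Set.mem_univ x)
    change |R (rescale a r φ) - Λ (rescale a r φ)| ≤ _ at h3
    change |R (rescale a r φ) - distrOf (fun _ => y) (rescale a r φ)| ≤ _
    have h5 := abs_sub_le (R (rescale a r φ)) (Λ (rescale a r φ))
      (distrOf (fun _ => y) (rescale a r φ))
    rw [add_zero]
    linarith

end Main

end PtDiff

end

theorem theorem4p14 {n : ℕ} (hn : 0 < n) (i k : ℕ) {Y : Type*} [NormedAddCommGroup Y]
    [NormedSpace ℝ Y] [CompleteSpace Y] [SeparableSpace Y] (R : PtDiff.Distr n Y)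
    (A : Set (EuclideanSpace ℝ (Fin n)))
    (hA : A = {a | PtDiff.NuPointwiseDifferentiableHolder
        (PtDiff.nu i (Metric.closedBall 0 1)) R ((k : ℤ) - 1) 1 a ∧
      ∀ m < k, PtDiff.HasPointwiseDifferential R m a 0}) :
    ∀ᵐ a ∂volume, a ∈ A →
      PtDiff.PointwiseDifferentiable R k a ∧
      (0 < k ∨ SeparableSpace (StrongDual ℝ Y) →
        PtDiff.NuPointwiseDifferentiable (PtDiff.nu i (Metric.closedBall 0 1)) R k a) ∧
      (0 < k → PtDiff.HasPointwiseDifferential R k a 0) := by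
  -- The vanishing differentials remove the polynomial, leaving a pure bound on `R` that places `a`
  -- in one of countably many sets.
  have hmem : ∀ a ∈ A, ∃ N, a ∈ PtDiff.boundedOrderSet R i k N := by
    rw [hA]
    rintro a ⟨⟨P, hP, hlim⟩, h0⟩
    obtain ⟨C, hC, hbound⟩ := PtDiff.exists_bound_of_limsup_lt_top
      (T := (R - PtDiff.distrOf P : PtDiff.Distr n Y).toLinearMap) hlim
    have hP0 : P = fun _ => 0 :=
      funext (PtDiff.eq_zero_of_hasPointwiseDifferential_zero hP hC hbound h0)
    rw [hP0, PtDiff.distrOf_const_zero, sub_zero] at hbound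
    exact PtDiff.exists_mem_boundedOrderSet hbound
  rcases Nat.eq_zero_or_pos k with rfl | hk
  · filter_upwards [ae_all_iff.2 fun N => PtDiff.ae_exists_isJet_zero R i N] with a ha haA
    obtain ⟨N, hN⟩ := hmem a haA
    obtain ⟨⟨y, hy⟩, hunif⟩ := ha N hN
    refine ⟨⟨_, PtDiff.isJet_const_of_tendsto hy⟩, fun h => ?_, fun h => absurd h (lt_irrefl 0)⟩
    obtain ⟨y', hy'⟩ := hunif (h.resolve_left (lt_irrefl 0))
    exact ⟨_, PtDiff.isPolynomialOfDegreeLE_const 0 y',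
      PtDiff.tendsto_iSup_of_forall_eventually_le
        (T := (R - PtDiff.distrOf (fun _ => y') : PtDiff.Distr n Y).toLinearMap) hy'⟩
  · filter_upwards [ae_all_iff.2 fun N => PtDiff.ae_forall_eventually_le_of_pos R (i := i) hk N]
      with a ha haA
    obtain ⟨N, hN⟩ := hmem a haA
    have hsmall := ha N hN
    have hjet : PtDiff.IsJet R k a fun _ => 0 := PtDiff.isJet_const_of_tendsto
      (PtDiff.tendsto_of_forall_eventually_le
        (T := (R - PtDiff.distrOf (fun _ => 0) : PtDiff.Distr n Y).toLinearMap) hsmall)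
    refine ⟨⟨_, hjet⟩, fun _ => ⟨_, hjet.1, PtDiff.tendsto_iSup_of_forall_eventually_le
        (T := (R - PtDiff.distrOf (fun _ => 0) : PtDiff.Distr n Y).toLinearMap) hsmall⟩,
      fun _ => ⟨_, hjet, ?_⟩⟩
    exact congrFun (iteratedFDeriv_zero (𝕜 := ℝ) (n := k)) a
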